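/- **Registers and states.** Let $m\ge 0$ and let $\mathcal A=\mathcal B=(\mathbb C^2)^{\otimes m}$ be registers of $m$ qubits whose basis states are labelled by bit-strings in $\mathbb F_2^m$, and let $\mathcal W$ be an arbitrary complex Hilbert space. Consider states $$\phi=\sum_{a\in\mathbb F_2^m}\sqrt{p_a}\,|a\rangle_{\mathcal A}|\phi_a\rangle_{\mathcal W},\qquad p_a\ge 0,\quad \sum_a p_a=1,\quad \|\phi_a\|=1 .$$ A unitary $O_{\mathrm{ref}}$ on $\mathcal A\otimes\mathcal W$ *reflects about* $\phi$ if $O_{\mathrm{ref}}\phi=\phi$ and $O_{\mathrm{ref}}\chi=-\chi$ for every $\chi\in\operatorname{span}\{|a\rangle|\phi_a\rangle : a\in\mathbb F_2^m\}$ orthogonal to $\phi$; on the orthogonal complement of this span $O_{\mathrm{ref}}$ may be arbitrary (in particular, the reflection $2|\phi\rangle\langle\phi|-I$ is such a unitary). **Transducers.** A transducer $S=S(O)$ with an input oracle $O$ (a unitary on $\mathcal A\otimes\mathcal W$) is a query algorithm $S(O)=U_Q\tilde O U_{Q-1}\tilde O\cdots\tilde O U_0$ on a Hilbert space $\mathcal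 H\oplus\mathcal L$ ($\mathcal H$ is the public space, $\mathcal L$ the private space), where the unitaries $U_t$ do not depend on $O$, and the query operator $\tilde O$ applies $O$ to the registers $\mathcal A\otimes\mathcal W$ if a control qubit is $1$ and is the identity if it is $0$. Here $\mathcal H\oplus\mathcal L$ consists of $\mathcal B$, $\mathcal A$, $\mathcal W$, the control qubit, finitely many ancilla qubits, and one counter register $\ell^2(\mathbb Z)$; the public space is $\mathcal H=\mathcal B\otimes\mathcal A\otimes\mathcal W$, embedded as the subspace where the control qubit, the ancillas and the counter are zero, and $\mathcal L=\mathcal H^\perp$. For $\xi,\tau\in\mathcal H$, $S(O)$ *transduces* $\xi$ into $\tau$, written $S(O)\colon\xi\rightsquigarrow\tau$, with catalyst $v\in\mathcal L$ if $S(O)(\xi\oplus v)=\tau\oplus v$. For this catalyst, the *transduction complexity* is $\|v\|^2$, and the *query complexity* is $\sum_{t=1}^{Q}\|\psi_t^\bullet\|^2$, where $\psi_t=U_{t-1}\tilde O\cdots\tilde O U_0(\xi\oplus v)$ is the state right before the $t$-th query, and $\psi_t^\bullet$ is its component with the control qubit equal to $1$. The *iteration time* is the total number of elementary operations in circuits implementing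 $U_0,\dots,U_Q$. Elementary operations are arbitrary 1- and 2-qubit unitaries on the qubits, the increment and the decrement of the counter controlled by one qubit, and the operation that flips a given qubit if the counter is non-zero. **Statement.** There is an absolute constant $C$ such that for all $m$ and $\mathcal W$ there exists a transducer $S''=S''(O)$ as above, with iteration time at most $Cm$, such that the following holds for all $p,\phi_a,r$ and $O_{\mathrm{ref}}$: if $p_r>\frac12$ and $O_{\mathrm{ref}}$ reflects about $\phi$, then, with $\delta=p_r-\frac12$, $$S''(O_{\mathrm{ref}})\colon\ |0\rangle_{\mathcal B}|\phi\rangle_{\mathcal A\mathcal W}\ \rightsquigarrow\ |r\rangle_{\mathcal B}|\phi\rangle_{\mathcal A\mathcal W},$$ and there is a catalyst for this transduction with which its query complexity is at most $\frac1{2\delta}$ and its transduction complexity is at most $\frac C\delta$. -/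

import Mathlib

/-! Quantum query algorithms and transducers over qubit registers, one work register with an
arbitrary Hilbert space `W`, and one counter register holding an integer. -/

/-- Bit-strings indexed by `ι`, as vectors over the field with two elements. -/
abbrev Bits (ι : Type) : Type := ι → ZMod 2

noncomputable section

open scoped ENNReal

/-- The Hilbert space `(ℂ²)^{⊗d} ⊗ W`: the vector `∑ a, |a⟩ ⊗ w a` is the family `w`. -/
abbrev QubitsTensor (d : ℕ) (W : Type*) [NormedAddCommGroup W] : Type _ :=
  PiLp 2 (fun _ : Bits (Fin d) => W)

/-- A basis configuration: the values of all qubits, and the value of the counter. -/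
abbrev Config (Q : Type) : Type := Bits Q × ℤ

/-- The total Hilbert space `(ℂ²)^{⊗Q} ⊗ ℓ²(ℤ) ⊗ W`: the vector `∑ (x, n), |x⟩|n⟩ ⊗ w (x, n)` is
the square-summable family `w`. -/
abbrev StateSpace (Q : Type) (W : Type*) [NormedAddCommGroup W] : Type _ :=
  lp (fun _ : Config Q => W) 2

/-! ### Unitaries of the total space from linear maps on families of vectors -/

section Unitaries

variable {I : Type} {W : Type*} [NormedAddCommGroup W]

/-- The squared `ℓ²`-norm of a family, possibly infinite. -/
def energy (ψ : I → W) : ℝ≥0∞ := ∑' i, ‖ψ i‖ₑ ^ 2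

lemma energy_ne_top_iff (ψ : I → W) : energy ψ ≠ ∞ ↔ Memℓp ψ 2 := by
  rw [memℓp_gen_iff (by norm_num)]
  have h : ∀ i, ‖ψ i‖ₑ ^ 2 = ((‖ψ i‖₊ ^ 2 : NNReal) : ℝ≥0∞) := fun i => by
    simp [enorm_eq_nnnorm]
  simp only [energy, h]
  rw [ENNReal.tsum_coe_ne_top_iff_summable, ← NNReal.summable_coe]
  simp

lemma energy_coe (ψ : lp (fun _ : I => W) 2) : energy (ψ : I → W) = ENNReal.ofReal (‖ψ‖ ^ 2) := by
  have h2 := lp.norm_rpow_eq_tsum (p := 2) (by norm_num) ψ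
  have hs := (memℓp_gen_iff (p := 2) (by norm_num)).1 (lp.memℓp ψ)
  simp only [ENNReal.toReal_ofNat, Real.rpow_ofNat] at h2 hs
  rw [h2, ENNReal.ofReal_tsum_of_nonneg (fun _ => by positivity) hs]
  refine tsum_congr fun i => ?_
  rw [ENNReal.ofReal_pow (norm_nonneg _), ofReal_norm]

variable [InnerProductSpace ℂ W]

/-- An invertible linear map on families that preserves the squared `ℓ²`-norm restricts to a
unitary of the Hilbert space of square-summable families. -/
def unitaryOfEnergy (T : (I → W) ≃ₗ[ℂ] (I → W)) (hT : ∀ ψ, energy (T ψ) = energy ψ) :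
    lp (fun _ : I => W) 2 ≃ₗᵢ[ℂ] lp (fun _ : I => W) 2 where
  toFun ψ := ⟨T ψ, (energy_ne_top_iff _).1 (by
    rw [hT]; exact (energy_ne_top_iff _).2 (lp.memℓp ψ))⟩
  invFun ψ := ⟨T.symm ψ, (energy_ne_top_iff _).1 (by
    rw [← hT, T.apply_symm_apply]; exact (energy_ne_top_iff _).2 (lp.memℓp ψ))⟩
  map_add' ψ χ := by
    apply lp.ext
    simp only [lp.coeFn_add]
    exact map_add T (ψ : I → W) (χ : I → W)
  map_smul' c ψ := by
    apply lp.ext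
    simp only [lp.coeFn_smul]
    exact map_smul T c (ψ : I → W)
  left_inv ψ := lp.ext (T.symm_apply_apply _)
  right_inv ψ := lp.ext (T.apply_symm_apply _)
  norm_map' ψ := by
    have h := hT ψ
    rw [energy_coe ψ] at h
    have h' := energy_coe (⟨T ψ, (energy_ne_top_iff _).1 (by
      rw [hT]; exact (energy_ne_top_iff _).2 (lp.memℓp ψ))⟩ : lp (fun _ : I => W) 2)
    have h3 := h'.symm.trans h
    rw [ENNReal.ofReal_eq_ofReal_iff (by positivity) (by positivity)] at h3
    exact (sq_eq_sq₀ (norm_nonneg _) (norm_nonneg _)).1 h3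

@[simp] lemma unitaryOfEnergy_apply (T : (I → W) ≃ₗ[ℂ] (I → W))
    (hT : ∀ ψ, energy (T ψ) = energy ψ) (ψ : lp (fun _ : I => W) 2) (i : I) :
    unitaryOfEnergy T hT ψ i = T ψ i := rfl

/-- The unitary that permutes the basis: `|i⟩ ⊗ w ↦ |σ i⟩ ⊗ w`. -/
def permUnitary (σ : I ≃ I) : lp (fun _ : I => W) 2 ≃ₗᵢ[ℂ] lp (fun _ : I => W) 2 :=
  unitaryOfEnergy (LinearEquiv.funCongrLeft ℂ W σ.symm) fun ψ =>
    σ.symm.tsum_eq fun i => ‖ψ i‖ₑ ^ 2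

@[simp] lemma permUnitary_apply (σ : I ≃ I) (ψ : lp (fun _ : I => W) 2) (i : I) :
    permUnitary σ ψ i = ψ (σ.symm i) := rfl

end Unitaries

section Fibers

variable {Q : Type} {d : ℕ} {W : Type*} [NormedAddCommGroup W]

/-- The vector in `(ℂ²)^{⊗d} ⊗ W` formed by the qubits `q` and the work register, when the other
qubits are as in the configuration `s` and the counter is as in `s`. -/
def fiber (q : Fin d ↪ Q) (ψ : Config Q → W) (s : Config Q) : QubitsTensor d W :=
  WithLp.toLp 2 fun y => ψ (Function.extend q y s.1, s.2)

lemma extend_extend (q : Fin d ↪ Q) (y y' : Bits (Fin d)) (x : Bits Q) :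
    Function.extend q y (Function.extend q y' x) = Function.extend q y x := by
  funext j
  by_cases h : ∃ i, q i = j
  · obtain ⟨i, rfl⟩ := h
    simp [q.injective.extend_apply]
  · simp [Function.extend_apply' _ _ _ h]

lemma extend_comp_self (q : Fin d ↪ Q) (x : Bits Q) : Function.extend q (x ∘ q) x = x := by
  funext j
  by_cases h : ∃ i, q i = j
  · obtain ⟨i, rfl⟩ := h
    simp [q.injective.extend_apply]
  · simp [Function.extend_apply' _ _ _ h]

/-- Exchange the values of the qubits `q` with a separate bit-string. -/
def exchange (q : Fin d ↪ Q) : Config Q × Bits (Fin d) ≃ Config Q × Bits (Fin d) where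
  toFun s := ((Function.extend q s.2 s.1.1, s.1.2), s.1.1 ∘ q)
  invFun s := ((Function.extend q s.2 s.1.1, s.1.2), s.1.1 ∘ q)
  left_inv s := by
    simp only [extend_extend, Function.extend_comp q.injective, extend_comp_self]
  right_inv s := by
    simp only [extend_extend, Function.extend_comp q.injective, extend_comp_self]

lemma tsum_fiber (q : Fin d ↪ Q) (f : Config Q → ℝ≥0∞) :
    ∑' s : Config Q, ∑ y : Bits (Fin d), f (Function.extend q y s.1, s.2)
      = Fintype.card (Bits (Fin d)) * ∑' s, f s := by
  have h1 : ∑' s : Config Q, ∑' y : Bits (Fin d), f (Function.extend q y s.1, s.2)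
      = ∑' s : Config Q, ∑' _ : Bits (Fin d), f s := by
    have h := (exchange q).tsum_eq fun s : Config Q × Bits (Fin d) => f s.1
    rw [ENNReal.tsum_prod' (f := fun s : Config Q × Bits (Fin d) => f ((exchange q) s).1),
      ENNReal.tsum_prod' (f := fun s : Config Q × Bits (Fin d) => f s.1)] at h
    exact h
  simp only [tsum_fintype, Finset.sum_const, nsmul_eq_mul, Finset.card_univ] at h1
  rw [h1, ENNReal.tsum_mul_left]

lemma energy_eq_of_fiber (q : Fin d ↪ Q) (ψ χ : Config Q → W)
    (h : ∀ s, ‖fiber q ψ s‖ = ‖fiber q χ s‖) : energy ψ = energy χ := by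
  have key : ∀ (ψ : Config Q → W) s,
      ∑ y : Bits (Fin d), ‖ψ (Function.extend q y s.1, s.2)‖ₑ ^ 2 = ENNReal.ofReal (‖fiber q ψ s‖ ^ 2) := by
    intro ψ s
    rw [PiLp.norm_sq_eq_of_L2, ENNReal.ofReal_sum_of_nonneg (fun _ _ => by positivity)]
    refine Finset.sum_congr rfl fun y _ => ?_
    rw [ENNReal.ofReal_pow (norm_nonneg _), ofReal_norm]
    rfl
  have h1 := tsum_fiber q fun s => ‖ψ s‖ₑ ^ 2
  have h2 := tsum_fiber q fun s => ‖χ s‖ₑ ^ 2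
  simp only [key, h] at h1 h2
  have h3 := h1.symm.trans h2
  exact (ENNReal.mul_right_inj (by simp) (by simp)).1 h3

variable [InnerProductSpace ℂ W]

/-- Apply a unitary `V x` of `(ℂ²)^{⊗d} ⊗ W` to the qubits `q` and the work register, where `V x`
may depend on the values `x` of the qubits other than `q`. -/
def fiberUnitary (q : Fin d ↪ Q) (V : Bits Q → (QubitsTensor d W ≃ₗᵢ[ℂ] QubitsTensor d W))
    (hV : ∀ y x, V (Function.extend q y x) = V x) : StateSpace Q W ≃ₗᵢ[ℂ] StateSpace Q W :=
  have comp : ∀ (U : Bits Q → (QubitsTensor d W ≃ₗᵢ[ℂ] QubitsTensor d W))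
      (_ : ∀ y x, U (Function.extend q y x) = U x) (ψ : Config Q → W) (s : Config Q),
      fiber q (fun s => U s.1 (fiber q ψ s) (s.1 ∘ q)) s = U s.1 (fiber q ψ s) := by
    intro U hU ψ s
    ext y
    simp only [fiber, hU, extend_extend, Function.extend_comp q.injective]
  unitaryOfEnergy
    { toFun := fun ψ s => V s.1 (fiber q ψ s) (s.1 ∘ q)
      invFun := fun ψ s => (V s.1).symm (fiber q ψ s) (s.1 ∘ q)
      map_add' := fun ψ χ => by
        funext s
        have : fiber q (ψ + χ) s = fiber q ψ s + fiber q χ s := rfl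
        simp [this]
      map_smul' := fun c ψ => by
        funext s
        have : fiber q (c • ψ) s = c • fiber q ψ s := rfl
        simp [this]
      left_inv := fun ψ => by
        funext s
        simp only
        rw [comp V hV]
        simp [fiber, extend_comp_self]
      right_inv := fun ψ => by
        funext s
        simp only
        rw [comp (fun x => (V x).symm) (fun y x => by rw [hV])]
        simp [fiber, extend_comp_self] }
    fun ψ => energy_eq_of_fiber q _ _ fun s => by
      change ‖fiber q (fun s => V s.1 (fiber q ψ s) (s.1 ∘ q)) s‖ = _
      rw [comp V hV, LinearIsometryEquiv.norm_map]

@[simp] lemma fiberUnitary_apply (q : Fin d ↪ Q)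
    (V : Bits Q → (QubitsTensor d W ≃ₗᵢ[ℂ] QubitsTensor d W))
    (hV : ∀ y x, V (Function.extend q y x) = V x) (ψ : StateSpace Q W) (s : Config Q) :
    fiberUnitary q V hV ψ s = V s.1 (fiber q ψ s) (s.1 ∘ q) := rfl

lemma norm_sum_smul (M : Bits (Fin d) → Bits (Fin d) → ℂ)
    (hM : ∀ z z', ∑ y, star (M y z) * M y z' = if z = z' then 1 else 0) (ψ : QubitsTensor d W) :
    ‖(WithLp.toLp 2 fun y => ∑ z, M y z • ψ z : QubitsTensor d W)‖ = ‖ψ‖ := by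
  have h : (inner ℂ (WithLp.toLp 2 fun y => ∑ z, M y z • ψ z : QubitsTensor d W)
      (WithLp.toLp 2 fun y => ∑ z, M y z • ψ z : QubitsTensor d W) : ℂ) = inner ℂ ψ ψ := by
    simp only [PiLp.inner_apply]
    calc ∑ y, inner ℂ (∑ z, M y z • ψ z) (∑ z, M y z • ψ z)
        = ∑ y, ∑ z, ∑ z', star (M y z) * M y z' * inner ℂ (ψ z) (ψ z') := by
          refine Finset.sum_congr rfl fun y _ => ?_
          rw [sum_inner]
          refine Finset.sum_congr rfl fun z _ => ?_
          rw [inner_sum]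
          refine Finset.sum_congr rfl fun z' _ => ?_
          rw [inner_smul_left, inner_smul_right, starRingEnd_apply, mul_assoc]
      _ = ∑ z, ∑ z', (∑ y, star (M y z) * M y z') * inner ℂ (ψ z) (ψ z') := by
          rw [Finset.sum_comm]
          refine Finset.sum_congr rfl fun z _ => ?_
          rw [Finset.sum_comm]
          refine Finset.sum_congr rfl fun z' _ => ?_
          rw [Finset.sum_mul]
      _ = ∑ z, inner ℂ (ψ z) (ψ z) := by
          simp only [hM, ite_mul, one_mul, zero_mul, Finset.sum_ite_eq, Finset.mem_univ, if_true]
  rw [inner_self_eq_norm_sq_to_K, inner_self_eq_norm_sq_to_K] at h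
  have h' : ‖(WithLp.toLp 2 fun y => ∑ z, M y z • ψ z : QubitsTensor d W)‖ ^ 2 = ‖ψ‖ ^ 2 := by
    exact_mod_cast h
  exact (sq_eq_sq₀ (norm_nonneg _) (norm_nonneg _)).1 h'

/-- The unitary `U ⊗ I` of `(ℂ²)^{⊗d} ⊗ W`. -/
def matrixTensorId (U : Matrix.unitaryGroup (Bits (Fin d)) ℂ) :
    QubitsTensor d W ≃ₗᵢ[ℂ] QubitsTensor d W where
  toFun ψ := WithLp.toLp 2 fun y => ∑ z, (U : Matrix (Bits (Fin d)) (Bits (Fin d)) ℂ) y z • ψ z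
  invFun ψ := WithLp.toLp 2 fun y =>
    ∑ z, ((U⁻¹ : Matrix.unitaryGroup (Bits (Fin d)) ℂ) : Matrix (Bits (Fin d)) (Bits (Fin d)) ℂ) y z • ψ z
  map_add' ψ χ := by
    ext y
    simp [Finset.sum_add_distrib]
  map_smul' c ψ := by
    ext y
    simp [Finset.smul_sum, smul_comm c]
  left_inv ψ := by
    ext y
    have h : ∀ z, ∑ x, ((U⁻¹ : Matrix.unitaryGroup (Bits (Fin d)) ℂ) : Matrix (Bits (Fin d)) (Bits (Fin d)) ℂ) y x *
        (U : Matrix (Bits (Fin d)) (Bits (Fin d)) ℂ) x z = if y = z then 1 else 0 := by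
      intro z
      rw [← Matrix.mul_apply, ← Submonoid.coe_mul, inv_mul_cancel]
      simp [Matrix.one_apply]
    simp only [Finset.smul_sum, smul_smul]
    rw [Finset.sum_comm]
    simp only [← Finset.sum_smul, h]
    simp
  right_inv ψ := by
    ext y
    have h : ∀ z, ∑ x, (U : Matrix (Bits (Fin d)) (Bits (Fin d)) ℂ) y x *
        ((U⁻¹ : Matrix.unitaryGroup (Bits (Fin d)) ℂ) : Matrix (Bits (Fin d)) (Bits (Fin d)) ℂ) x z
          = if y = z then 1 else 0 := by
      intro z
      rw [← Matrix.mul_apply, ← Submonoid.coe_mul, mul_inv_cancel]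
      simp [Matrix.one_apply]
    simp only [Finset.smul_sum, smul_smul]
    rw [Finset.sum_comm]
    simp only [← Finset.sum_smul, h]
    simp
  norm_map' ψ := norm_sum_smul (fun y z => (U : Matrix (Bits (Fin d)) (Bits (Fin d)) ℂ) y z)
    (fun z z' => by
      have h := congrFun (congrFun (Matrix.mem_unitaryGroup_iff'.1 U.2) z) z'
      simpa [Matrix.mul_apply, Matrix.star_apply, Matrix.one_apply] using h) ψ

@[simp] lemma matrixTensorId_apply (U : Matrix.unitaryGroup (Bits (Fin d)) ℂ)
    (ψ : QubitsTensor d W) (y : Bits (Fin d)) :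
    matrixTensorId U ψ y = ∑ z, (U : Matrix (Bits (Fin d)) (Bits (Fin d)) ℂ) y z • ψ z := rfl

end Fibers

/-! ### Elementary operations -/

/-- The elementary operations on a set `Q` of qubits and the counter: arbitrary 1- and 2-qubit
unitaries; incrementing or decrementing the counter controlled by a qubit; testing whether the
counter is non-zero into a qubit. None of them touches the work register. -/
inductive Gate (Q : Type) : Type
  /-- a unitary `U` on the `d` distinct qubits `q 0, …, q (d - 1)`, where `d` is 1 or 2 -/
  | qubits (d : ℕ) (hd : d = 1 ∨ d = 2) (q : Fin d ↪ Q)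
      (U : Matrix.unitaryGroup (Bits (Fin d)) ℂ) : Gate Q
  /-- `|x⟩|n⟩ ↦ |x⟩|n + 1⟩` if the qubit `c` of `x` is 1, the identity otherwise -/
  | increment (c : Q) : Gate Q
  /-- `|x⟩|n⟩ ↦ |x⟩|n - 1⟩` if the qubit `c` of `x` is 1, the identity otherwise -/
  | decrement (c : Q) : Gate Q
  /-- flips the qubit `c` if the counter is non-zero -/
  | nonzeroTest (c : Q) : Gate Q

section Circuits

variable {Q : Type} [DecidableEq Q] {W : Type*} [NormedAddCommGroup W] [InnerProductSpace ℂ W]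

/-- The permutation of the configurations made by a controlled increment. -/
def incrementPerm (c : Q) : Config Q ≃ Config Q where
  toFun s := (s.1, if s.1 c = 1 then s.2 + 1 else s.2)
  invFun s := (s.1, if s.1 c = 1 then s.2 - 1 else s.2)
  left_inv s := by by_cases h : s.1 c = 1 <;> simp [h]
  right_inv s := by by_cases h : s.1 c = 1 <;> simp [h]

/-- The permutation of the configurations made by a test of the counter. -/
def nonzeroTestPerm (c : Q) : Config Q ≃ Config Q where
  toFun s := (if s.2 ≠ 0 then Function.update s.1 c (s.1 c + 1) else s.1, s.2)
  invFun s := (if s.2 ≠ 0 then Function.update s.1 c (s.1 c + 1) else s.1, s.2)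
  left_inv s := by
    obtain ⟨x, n⟩ := s
    by_cases h : n = 0 <;> simp [h, add_assoc, CharTwo.add_self_eq_zero]
  right_inv s := by
    obtain ⟨x, n⟩ := s
    by_cases h : n = 0 <;> simp [h, add_assoc, CharTwo.add_self_eq_zero]

/-- The unitary performed by an elementary operation. -/
def Gate.unitary (W : Type*) [NormedAddCommGroup W] [InnerProductSpace ℂ W] :
    Gate Q → (StateSpace Q W ≃ₗᵢ[ℂ] StateSpace Q W)
  | .qubits _ _ q U => fiberUnitary q (fun _ => matrixTensorId U) fun _ _ => rfl
  | .increment c => permUnitary (incrementPerm c)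
  | .decrement c => permUnitary (incrementPerm c).symm
  | .nonzeroTest c => permUnitary (nonzeroTestPerm c)

/-- The unitary performed by a circuit, the head of the list being executed first. -/
def circuitUnitary (W : Type*) [NormedAddCommGroup W] [InnerProductSpace ℂ W] :
    List (Gate Q) → (StateSpace Q W ≃ₗᵢ[ℂ] StateSpace Q W)
  | [] => LinearIsometryEquiv.refl ℂ _
  | g :: gs => (g.unitary W).trans (circuitUnitary W gs)

end Circuits

/-! ### Query algorithms on the registers `B`, `A`, `W` -/

/-- The qubits: those of `B`, those of `A`, the control qubit of the queries, and `k` ancillas. -/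
abbrev Qubit (m k : ℕ) : Type := Fin m ⊕ Fin m ⊕ Unit ⊕ Fin k

/-- The `i`-th qubit of `B`. -/
abbrev Qubit.B {m k : ℕ} (i : Fin m) : Qubit m k := .inl i

/-- The `i`-th qubit of `A`. -/
abbrev Qubit.A {m k : ℕ} (i : Fin m) : Qubit m k := .inr (.inl i)

/-- The qubit that controls the queries. -/
abbrev Qubit.ctrl {m k : ℕ} : Qubit m k := .inr (.inr (.inl ()))

/-- The `i`-th ancilla. -/
abbrev Qubit.anc {m k : ℕ} (i : Fin k) : Qubit m k := .inr (.inr (.inr i))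

/-- The qubits of `A` among all qubits. -/
def regA (m k : ℕ) : Fin m ↪ Qubit m k := ⟨Qubit.A, fun _ _ h => by simpa using h⟩

/-- An input oracle: a unitary on `A ⊗ W`. -/
abbrev Oracle (m : ℕ) (W : Type*) [NormedAddCommGroup W] [InnerProductSpace ℂ W] : Type _ :=
  QubitsTensor m W ≃ₗᵢ[ℂ] QubitsTensor m W

/-- The query operator: `O` is applied to `A ⊗ W` if the control qubit is 1, and the identity
otherwise. -/
def queryOp {m : ℕ} (k : ℕ) {W : Type*} [NormedAddCommGroup W] [InnerProductSpace ℂ W]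
    (O : Oracle m W) : StateSpace (Qubit m k) W ≃ₗᵢ[ℂ] StateSpace (Qubit m k) W :=
  fiberUnitary (regA m k)
    (fun x => if x Qubit.ctrl = 1 then O else LinearIsometryEquiv.refl ℂ _)
    (fun y x => by
      rw [Function.extend_apply' _ _ _ (by
        rintro ⟨i, hi⟩
        have h : (Sum.inr (Sum.inl i) : Qubit m k) = Sum.inr (Sum.inr (Sum.inl ())) := hi
        simp at h)])

/-- The squared norm of the part of the state to which the query operator applies the oracle. -/
def queriedNormSq {m k : ℕ} {W : Type*} [NormedAddCommGroup W]
    (ψ : StateSpace (Qubit m k) W) : ℝ :=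
  ∑' s : Config (Qubit m k), if s.1 Qubit.ctrl = 1 then ‖ψ s‖ ^ 2 else 0

/-- A quantum query algorithm `U_Q Õ U_{Q-1} Õ ⋯ Õ U_0` in the circuit model; only the circuits
`U 0, …, U Q` are used. It does not depend on the input oracle. -/
structure QueryAlgorithm (m k : ℕ) where
  /-- the number of queries -/
  Q : ℕ
  /-- the circuits between the queries -/
  U : ℕ → List (Gate (Qubit m k))

namespace QueryAlgorithm

variable {m k : ℕ} {W : Type*} [NormedAddCommGroup W] [InnerProductSpace ℂ W]

/-- The unitary `U_t Õ U_{t-1} Õ ⋯ Õ U_0`. -/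
def partialAction (S : QueryAlgorithm m k) (O : Oracle m W) :
    ℕ → (StateSpace (Qubit m k) W ≃ₗᵢ[ℂ] StateSpace (Qubit m k) W)
  | 0 => circuitUnitary W (S.U 0)
  | t + 1 => ((S.partialAction O t).trans (queryOp k O)).trans (circuitUnitary W (S.U (t + 1)))

/-- The unitary `S(O)` performed by the algorithm. -/
def action (S : QueryAlgorithm m k) (O : Oracle m W) :
    StateSpace (Qubit m k) W ≃ₗᵢ[ℂ] StateSpace (Qubit m k) W :=
  S.partialAction O S.Q

/-- The Las Vegas query complexity of the algorithm on the input oracle `O` and the initial state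
`ψ`: the sum over all queries of the squared norms of the parts of the states processed by the
oracle. -/
def lasVegas (S : QueryAlgorithm m k) (O : Oracle m W) (ψ : StateSpace (Qubit m k) W) : ℝ :=
  ∑ t ∈ Finset.range S.Q, queriedNormSq (S.partialAction O t ψ)

/-- The number of elementary operations in all the circuits of the algorithm. -/
def time (S : QueryAlgorithm m k) : ℕ :=
  ∑ t ∈ Finset.range (S.Q + 1), (S.U t).length

end QueryAlgorithm

/-! ### Transducers -/

/-- The unitary `S` of `K = H ⊕ Hᗮ`, considered as a transducer with public space `H` and private
space `Hᗮ`, transduces `ξ` into `τ` with catalyst `v`. -/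
def Transduces {K : Type*} [NormedAddCommGroup K] [InnerProductSpace ℂ K] (S : K ≃ₗᵢ[ℂ] K)
    (H : Submodule ℂ K) (ξ τ v : K) : Prop :=
  ξ ∈ H ∧ τ ∈ H ∧ v ∈ Hᗮ ∧ S (ξ + v) = τ + v

/-- The public space `B ⊗ A ⊗ W`: the vectors supported on the configurations where the control
qubit, all ancillas, and the counter are zero. -/
def publicSpace (m k : ℕ) (W : Type*) [NormedAddCommGroup W] [InnerProductSpace ℂ W] :
    Submodule ℂ (StateSpace (Qubit m k) W) where
  carrier := {ψ | ∀ s : Config (Qubit m k),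
    ¬ (s.2 = 0 ∧ s.1 Qubit.ctrl = 0 ∧ ∀ i, s.1 (Qubit.anc i) = 0) → ψ s = 0}
  add_mem' := fun {ψ χ} hψ hχ s hs => by
    rw [lp.coeFn_add, Pi.add_apply, hψ s hs, hχ s hs, add_zero]
  zero_mem' := fun s _ => by rw [lp.coeFn_zero, Pi.zero_apply]
  smul_mem' := fun c ψ hψ s hs => by
    rw [lp.coeFn_smul, Pi.smul_apply, hψ s hs, smul_zero]

/-- The configuration with `b` in `B`, `a` in `A`, and zero in all other registers. -/
def basisConfig {m : ℕ} (k : ℕ) (b a : Bits (Fin m)) : Config (Qubit m k) :=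
  (Sum.elim b (Sum.elim a 0), 0)

/-- The public state `|b⟩_B ⊗ Φ` for `Φ` in `A ⊗ W`. -/
def publicState {m : ℕ} (k : ℕ) {W : Type*} [NormedAddCommGroup W] (b : Bits (Fin m))
    (Φ : QubitsTensor m W) : StateSpace (Qubit m k) W :=
  ∑ a : Bits (Fin m), lp.single 2 (basisConfig k b a) (Φ a)

/-- The state `∑ a, √(p a) |a⟩_A ⊗ |φ a⟩_W`. -/
def answerState {m : ℕ} {W : Type*} [NormedAddCommGroup W] [InnerProductSpace ℂ W]
    (p : Bits (Fin m) → ℝ) (φ : Bits (Fin m) → W) : QubitsTensor m W :=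
  WithLp.toLp 2 fun a => (Real.sqrt (p a) : ℂ) • φ a

/-- The oracle `O` reflects about `∑ a, √(p a) |a⟩|φ a⟩`, at least within the span of the vectors
`|a⟩|φ a⟩`: it fixes this state and negates the vectors `∑ a, c a |a⟩|φ a⟩` orthogonal to it. Its
action on the orthogonal complement of the span is arbitrary. -/
def ReflectsAbout {m : ℕ} {W : Type*} [NormedAddCommGroup W] [InnerProductSpace ℂ W]
    (O : Oracle m W) (p : Bits (Fin m) → ℝ) (φ : Bits (Fin m) → W) : Prop :=
  O (answerState p φ) = answerState p φ ∧
  ∀ c : Bits (Fin m) → ℂ,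
    inner ℂ (answerState p φ) (WithLp.toLp 2 fun a => c a • φ a : QubitsTensor m W) = 0 →
    O (WithLp.toLp 2 fun a => c a • φ a) = -WithLp.toLp 2 fun a => c a • φ a

end

/-! The algorithm is that of Bernstein and Vazirani. Hadamard operations on `B` turn `|0⟩` into the
uniform superposition of all `|b⟩`, and `|r⟩` into the same superposition with signs `(-1)^(b ⬝ᵥ
r)`. By linearity it suffices to transduce, for each fixed `b`, the state `φ` into `(-1)^s φ` with
`s = b ⬝ᵥ r`. For fixed `b` the bit `f = b ⬝ᵥ a` is a noisy answer which equals `s` with probability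
`P ≥ p r > 1/2`.

The sign is produced by a walk on `ℤ`. The answer `f = 0` swaps the positions `2k - 1` and `2k`, the
answer `f = 1` swaps `2k` and `2k + 1`, and the oracle acts only away from the origin, where the
public state sits. Put `w = (1 - P) / P < 1`, and let `χ` be the function `negatedVector` of `f`. It
has mean zero under `p`, so the oracle fixes `φ` and negates the vector obtained from `φ` by
multiplying its components by `χ` (`ReflectsAbout.apply_add`). At each position the catalyst is a
multiple of only one of these two vectors, with coefficients decaying geometrically on both sides of
the origin. A query and a step of the walk, with the signs `walkPhase`, reproduce these
coefficients, while the unit amplitude at the origin comes back as `(-1)^s`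
(`walkPhase_mul_amplitude`).

The second moment of `χ` is `w`, so the catalyst for one `b` has squared norm `2^(-m)` times a sum
of geometric series with value `(1 + w) / (1 - w) = 1 / (2P - 1) ≤ 1 / (2δ)`
(`hasSum_amplitude_sq`); summing over the `2^m` values of `b` keeps this bound. There is a single
query, and the queried part of the state is the catalyst, since the public part is at the origin.
Hence the query complexity equals `‖v‖ ^ 2`. The circuits consist of `2m` Hadamard operations, two
evaluations of an inner product, and a constant number of gates for the walk. -/

/-! ### The sign character of the field with two elements -/

/-- The non-trivial additive character of `𝔽₂`. -/
def bitSign (z : ZMod 2) : ℂ := if z = 0 then 1 else -1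

@[simp] lemma bitSign_zero : bitSign 0 = 1 := by simp [bitSign]

@[simp] lemma bitSign_one : bitSign 1 = -1 := by simp [bitSign]

lemma zmod_two_cases (z : ZMod 2) : z = 0 ∨ z = 1 := by
  revert z
  decide

lemma sum_zmod_two {M : Type*} [AddCommMonoid M] (f : ZMod 2 → M) : ∑ z, f z = f 0 + f 1 :=
  Fin.sum_univ_two f

lemma bitSign_add (y z : ZMod 2) : bitSign (y + z) = bitSign y * bitSign z := by
  rcases zmod_two_cases y with rfl | rfl <;> rcases zmod_two_cases z with rfl | rfl <;>
    simp [CharTwo.add_self_eq_zero]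

lemma bitSign_mul_self (z : ZMod 2) : bitSign z * bitSign z = 1 := by
  rcases zmod_two_cases z with rfl | rfl <;> simp

lemma star_bitSign (z : ZMod 2) : star (bitSign z) = bitSign z := by
  rcases zmod_two_cases z with rfl | rfl <;> simp

lemma bitSign_sum {ι : Type*} (s : Finset ι) (f : ι → ZMod 2) :
    bitSign (∑ i ∈ s, f i) = ∏ i ∈ s, bitSign (f i) := by
  classical
  induction s using Finset.induction_on with
  | empty => simp
  | insert i s hi ih => rw [Finset.sum_insert hi, Finset.prod_insert hi, bitSign_add, ih]

lemma inv_sqrt_two_mul_self :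
    (((Real.sqrt 2)⁻¹ : ℝ) : ℂ) * ((Real.sqrt 2)⁻¹ : ℝ) = 1 / 2 := by
  rw [← Complex.ofReal_mul, ← mul_inv, Real.mul_self_sqrt (by norm_num)]
  norm_num

/-! ### Families of unitary matrices on one and two qubits -/

section Matrices

variable {d : ℕ}

/-- The diagonal unitary matrix with the given phases. -/
def diagonalUnitary (g : Bits (Fin d) → ℂ) (hg : ∀ y, star (g y) * g y = 1) :
    Matrix.unitaryGroup (Bits (Fin d)) ℂ :=
  ⟨Matrix.diagonal g, by
    rw [Matrix.mem_unitaryGroup_iff', Matrix.star_eq_conjTranspose, Matrix.diagonal_conjTranspose,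
      Matrix.diagonal_mul_diagonal]
    simp only [Pi.star_apply, hg, Matrix.diagonal_one]⟩

/-- The permutation matrix of an involution. -/
def involutionUnitary (e : Bits (Fin d) → Bits (Fin d)) (he : ∀ y, e (e y) = y) :
    Matrix.unitaryGroup (Bits (Fin d)) ℂ :=
  ⟨Matrix.of fun y z => if z = e y then 1 else 0, by
    rw [Matrix.mem_unitaryGroup_iff]
    ext y z
    have h : e z = e y ↔ y = z := ⟨fun h => by rw [← he y, ← h, he], fun h => by rw [h]⟩
    simp [Matrix.mul_apply, Matrix.star_apply, Matrix.one_apply, h]⟩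

/-- The Hadamard matrix. -/
noncomputable def hadamardUnitary : Matrix.unitaryGroup (Bits (Fin 1)) ℂ :=
  ⟨Matrix.of fun y z => ((Real.sqrt 2)⁻¹ : ℝ) * bitSign (y 0 * z 0), by
    rw [Matrix.mem_unitaryGroup_iff]
    ext y z
    have hyz : y = z ↔ y 0 = z 0 := by
      rw [funext_iff, Fin.forall_fin_one]
    rw [Matrix.mul_apply, Matrix.one_apply, ← (Equiv.funUnique (Fin 1) (ZMod 2)).symm.sum_comp,
      sum_zmod_two]
    simp only [hyz, Matrix.star_apply, Matrix.of_apply, star_mul', star_bitSign, RCLike.star_def,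
      Complex.conj_ofReal, Equiv.funUnique_symm_apply, uniqueElim_const]
    rcases zmod_two_cases (y 0) with hy | hy <;> rcases zmod_two_cases (z 0) with hz | hz <;>
      simp only [hy, hz, mul_zero, mul_one, bitSign_zero, bitSign_one, mul_neg, neg_mul, neg_neg,
        inv_sqrt_two_mul_self] <;> norm_num⟩

end Matrices

/-- The indicator of a non-zero counter. -/
def nonzeroBit (n : ℤ) : ZMod 2 := if n = 0 then 0 else 1

/-! ### The action of the elementary operations on families -/

section Action

variable {Q : Type} [DecidableEq Q] {W : Type*} [NormedAddCommGroup W] [InnerProductSpace ℂ W]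

/-- A single qubit, as a register. -/
def oneQubit (j : Q) : Fin 1 ↪ Q := ⟨fun _ => j, fun _ _ _ => Subsingleton.elim _ _⟩

/-- Two distinct qubits, as a register. -/
def twoQubits (i j : Q) (h : i ≠ j) : Fin 2 ↪ Q :=
  ⟨![i, j], by
    intro a b hab
    fin_cases a <;> fin_cases b <;> simp_all⟩

lemma extend_oneQubit (j : Q) (y : Bits (Fin 1)) (x : Bits Q) :
    Function.extend (oneQubit j) y x = Function.update x j (y 0) := by
  funext l
  by_cases h : l = j
  · subst h
    rw [Function.update_self]
    exact (oneQubit l).injective.extend_apply y x 0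
  · rw [Function.update_of_ne h, Function.extend_apply']
    rintro ⟨_, rfl⟩
    exact h rfl

lemma extend_twoQubits (i j : Q) (h : i ≠ j) (y : Bits (Fin 2)) (x : Bits Q) :
    Function.extend (twoQubits i j h) y x = Function.update (Function.update x i (y 0)) j (y 1) := by
  funext l
  by_cases hj : l = j
  · subst hj
    rw [Function.update_self]
    exact (twoQubits i l h).injective.extend_apply y x 1
  · rw [Function.update_of_ne hj]
    by_cases hi : l = i
    · subst hi
      rw [Function.update_self]
      exact (twoQubits l j h).injective.extend_apply y x 0
    · rw [Function.update_of_ne hi, Function.extend_apply']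
      rintro ⟨a, rfl⟩
      fin_cases a
      · exact hi rfl
      · exact hj rfl

lemma circuitUnitary_append (l₁ l₂ : List (Gate Q)) (ψ : StateSpace Q W) :
    circuitUnitary W (l₁ ++ l₂) ψ = circuitUnitary W l₂ (circuitUnitary W l₁ ψ) := by
  induction l₁ generalizing ψ with
  | nil => rfl
  | cons g l ih => exact ih (g.unitary W ψ)

lemma circuitUnitary_cons (g : Gate Q) (l : List (Gate Q)) (ψ : StateSpace Q W) :
    circuitUnitary W (g :: l) ψ = circuitUnitary W l (g.unitary W ψ) := rfl

lemma circuitUnitary_nil (ψ : StateSpace Q W) : circuitUnitary W ([] : List (Gate Q)) ψ = ψ := rfl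

lemma qubits_unitary_apply (d : ℕ) (hd : d = 1 ∨ d = 2) (q : Fin d ↪ Q)
    (U : Matrix.unitaryGroup (Bits (Fin d)) ℂ) (ψ : StateSpace Q W) (s : Config Q) :
    (Gate.qubits d hd q U).unitary W ψ s =
      ∑ z, (U : Matrix (Bits (Fin d)) (Bits (Fin d)) ℂ) (s.1 ∘ q) z •
        ψ (Function.extend q z s.1, s.2) := rfl

/-- The Hadamard operation on the qubit `j`. -/
noncomputable def hadamardGate (j : Q) : Gate Q := .qubits 1 (.inl rfl) (oneQubit j) hadamardUnitary

lemma hadamardGate_apply (j : Q) (ψ : StateSpace Q W) (x : Bits Q) (n : ℤ) :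
    (hadamardGate j).unitary W ψ (x, n) =
      (((Real.sqrt 2)⁻¹ : ℝ) : ℂ) • ∑ z, bitSign (x j * z) • ψ (Function.update x j z, n) := by
  rw [hadamardGate, qubits_unitary_apply, ← (Equiv.funUnique (Fin 1) (ZMod 2)).symm.sum_comp,
    Finset.smul_sum]
  refine Finset.sum_congr rfl fun z _ => ?_
  rw [extend_oneQubit, smul_smul]
  rfl

lemma hadamardGate_involutive (j : Q) (ψ : StateSpace Q W) :
    (hadamardGate j).unitary W ((hadamardGate j).unitary W ψ) = ψ := by
  apply lp.ext
  funext ⟨x, n⟩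
  have hx : x = Function.update x j (x j) := by simp
  simp only [hadamardGate_apply, Function.update_self, Function.update_idem, sum_zmod_two,
    smul_add, smul_smul, ← mul_assoc]
  rcases zmod_two_cases (x j) with h | h <;> conv_rhs => rw [hx, h]
  all_goals simp only [h, mul_zero, mul_one, bitSign_zero, bitSign_one, mul_neg, neg_mul, neg_neg,
    inv_sqrt_two_mul_self]
  all_goals module

/-- The diagonal operation with phases `g` on two qubits. -/
def diagonalGate (i j : Q) (h : i ≠ j) (g : ZMod 2 → ZMod 2 → ℂ)
    (hg : ∀ y z, star (g y z) * g y z = 1) : Gate Q :=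
  .qubits 2 (.inr rfl) (twoQubits i j h) (diagonalUnitary (fun y => g (y 0) (y 1)) fun _ => hg _ _)

lemma diagonalGate_apply (i j : Q) (h : i ≠ j) (g : ZMod 2 → ZMod 2 → ℂ)
    (hg : ∀ y z, star (g y z) * g y z = 1) (ψ : StateSpace Q W) (x : Bits Q) (n : ℤ) :
    (diagonalGate i j h g hg).unitary W ψ (x, n) = g (x i) (x j) • ψ (x, n) := by
  rw [diagonalGate, qubits_unitary_apply]
  simp only [diagonalUnitary, Matrix.diagonal_apply, ite_smul, zero_smul, Finset.sum_ite_eq,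
    Finset.mem_univ, if_true, extend_comp_self]
  rfl

/-- The controlled negation: adds the qubit `c` to the qubit `t`. -/
def cnotGate (c t : Q) (h : c ≠ t) : Gate Q :=
  .qubits 2 (.inr rfl) (twoQubits c t h) (involutionUnitary (fun y => ![y 0, y 1 + y 0]) fun y => by
    funext i
    fin_cases i <;> simp [add_assoc, CharTwo.add_self_eq_zero])

lemma cnotGate_apply (c t : Q) (h : c ≠ t) (ψ : StateSpace Q W) (x : Bits Q) (n : ℤ) :
    (cnotGate c t h).unitary W ψ (x, n) = ψ (Function.update x t (x t + x c), n) := by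
  rw [cnotGate, qubits_unitary_apply]
  simp only [involutionUnitary, Matrix.of_apply, ite_smul, zero_smul, one_smul, Finset.sum_ite_eq',
    Finset.mem_univ, if_true, extend_twoQubits]
  change ψ (Function.update (Function.update x c (x c)) t (x t + x c), n) = _
  rw [Function.update_eq_self]

/-- The negation of the qubit `j`. -/
def notGate (j : Q) : Gate Q :=
  .qubits 1 (.inl rfl) (oneQubit j) (involutionUnitary (fun y i => y i + 1) fun y => by
    funext i
    simp [add_assoc, CharTwo.add_self_eq_zero])

lemma notGate_apply (j : Q) (ψ : StateSpace Q W) (x : Bits Q) (n : ℤ) :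
    (notGate j).unitary W ψ (x, n) = ψ (Function.update x j (x j + 1), n) := by
  rw [notGate, qubits_unitary_apply]
  simp only [involutionUnitary, Matrix.of_apply, ite_smul, zero_smul, one_smul, Finset.sum_ite_eq',
    Finset.mem_univ, if_true, extend_oneQubit]
  rfl

lemma increment_apply (c : Q) (ψ : StateSpace Q W) (x : Bits Q) (n : ℤ) :
    (Gate.increment c).unitary W ψ (x, n) = ψ (x, if x c = 1 then n - 1 else n) := rfl

lemma decrement_apply (c : Q) (ψ : StateSpace Q W) (x : Bits Q) (n : ℤ) :
    (Gate.decrement c).unitary W ψ (x, n) = ψ (x, if x c = 1 then n + 1 else n) := rfl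

lemma nonzeroTest_apply (c : Q) (ψ : StateSpace Q W) (x : Bits Q) (n : ℤ) :
    (Gate.nonzeroTest c).unitary W ψ (x, n) =
      ψ (Function.update x c (x c + nonzeroBit n), n) := by
  change ψ (if n ≠ 0 then Function.update x c (x c + 1) else x, n) = _
  by_cases h : n = 0 <;> simp [h, nonzeroBit]

end Action

/-! ### Inner products of two registers -/

section InnerProduct

variable {Q : Type} [DecidableEq Q] {W : Type*} [NormedAddCommGroup W] [InnerProductSpace ℂ W]

/-- The phase `u` on two qubits applied if both of them are 1. -/
def jointPhase (u : ℂ) (y z : ZMod 2) : ℂ := if y = 1 ∧ z = 1 then u else 1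

lemma star_jointPhase_mul_self (u : ℂ) (hu : star u * u = 1) (y z : ZMod 2) :
    star (jointPhase u y z) * jointPhase u y z = 1 := by
  unfold jointPhase
  split_ifs
  · exact hu
  · simp

/-- A circuit for the doubly controlled phase `-1`. -/
def triplePhase (a b t : Q) (hab : a ≠ b) (hat : a ≠ t) (hbt : b ≠ t) : List (Gate Q) :=
  [diagonalGate a t hat (jointPhase Complex.I) (star_jointPhase_mul_self _ (by simp)),
    diagonalGate b t hbt (jointPhase Complex.I) (star_jointPhase_mul_self _ (by simp)),
    cnotGate a b hab,
    diagonalGate b t hbt (jointPhase (-Complex.I)) (star_jointPhase_mul_self _ (by simp)),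
    cnotGate a b hab]

/-- For bits, `x a + x b - (x a ⊕ x b) = 2 * x a * x b` over the integers. The two phases `I` and
the phase `-I` on the sum of `a` and `b` therefore multiply to `I ^ 2 = -1` when all three qubits
are 1, and to 1 otherwise. -/
lemma triplePhase_apply (a b t : Q) (hab : a ≠ b) (hat : a ≠ t) (hbt : b ≠ t)
    (ψ : StateSpace Q W) (x : Bits Q) (n : ℤ) :
    circuitUnitary W (triplePhase a b t hab hat hbt) ψ (x, n) =
      bitSign (x a * x b * x t) • ψ (x, n) := by
  simp only [triplePhase, circuitUnitary_cons, circuitUnitary_nil, cnotGate_apply,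
    diagonalGate_apply, Function.update_self, Function.update_of_ne hab,
    Function.update_of_ne hbt.symm, Function.update_idem, smul_smul]
  rw [add_assoc, CharTwo.add_self_eq_zero, add_zero, Function.update_eq_self]
  congr 1
  rcases zmod_two_cases (x a) with h1 | h1 <;> rcases zmod_two_cases (x b) with h2 | h2 <;>
    rcases zmod_two_cases (x t) with h3 | h3 <;>
    simp [h1, h2, h3, jointPhase, CharTwo.add_self_eq_zero]

/-- A circuit for the phase given by the inner product of two registers, controlled by `t`. -/
def innerPhase {ι : Type} (a b : ι → Q) (t : Q) (hab : ∀ i, a i ≠ b i) (hat : ∀ i, a i ≠ t)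
    (hbt : ∀ i, b i ≠ t) (l : List ι) : List (Gate Q) :=
  l.flatMap fun i => triplePhase (a i) (b i) t (hab i) (hat i) (hbt i)

lemma innerPhase_apply {ι : Type} (a b : ι → Q) (t : Q) (hab : ∀ i, a i ≠ b i)
    (hat : ∀ i, a i ≠ t) (hbt : ∀ i, b i ≠ t) (l : List ι) (ψ : StateSpace Q W) (x : Bits Q)
    (n : ℤ) :
    circuitUnitary W (innerPhase a b t hab hat hbt l) ψ (x, n) =
      bitSign ((l.map fun i => x (a i) * x (b i)).sum * x t) • ψ (x, n) := by
  induction l generalizing ψ with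
  | nil => simp [innerPhase, circuitUnitary_nil]
  | cons i l ih =>
    have h : innerPhase a b t hab hat hbt (i :: l) =
      triplePhase (a i) (b i) t (hab i) (hat i) (hbt i) ++ innerPhase a b t hab hat hbt l := rfl
    rw [h, circuitUnitary_append, ih, triplePhase_apply, smul_smul, ← bitSign_add, List.map_cons,
      List.sum_cons, add_mul, add_comm]

/-- A circuit that adds the inner product of two registers of `m` qubits to the qubit `t`. -/
noncomputable def addInnerProduct {m : ℕ} (a b : Fin m → Q) (t : Q) (hab : ∀ i, a i ≠ b i)
    (hat : ∀ i, a i ≠ t) (hbt : ∀ i, b i ≠ t) : List (Gate Q) :=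
  hadamardGate t :: (innerPhase a b t hab hat hbt (List.finRange m) ++ [hadamardGate t])

omit [DecidableEq Q] in
lemma addInnerProduct_length {m : ℕ} (a b : Fin m → Q) (t : Q) (hab : ∀ i, a i ≠ b i)
    (hat : ∀ i, a i ≠ t) (hbt : ∀ i, b i ≠ t) :
    (addInnerProduct a b t hab hat hbt).length = 5 * m + 2 := by
  simp [addInnerProduct, innerPhase, triplePhase]
  ring

/-- Conjugation by the Hadamard operation on `t` turns a sign conditional on `t` into a negation of
`t`. Since addition is modulo 2, the same circuit also erases the inner product. -/
lemma addInnerProduct_apply {m : ℕ} (a b : Fin m → Q) (t : Q) (hab : ∀ i, a i ≠ b i)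
    (hat : ∀ i, a i ≠ t) (hbt : ∀ i, b i ≠ t) (ψ : StateSpace Q W) (x : Bits Q) (n : ℤ) :
    circuitUnitary W (addInnerProduct a b t hab hat hbt) ψ (x, n) =
      ψ (Function.update x t (x t + (x ∘ a) ⬝ᵥ (x ∘ b)), n) := by
  have hsum : ∀ z, ((List.finRange m).map fun i =>
      Function.update x t z (a i) * Function.update x t z (b i)).sum = (x ∘ a) ⬝ᵥ (x ∘ b) := by
    intro z
    simp only [Function.update_of_ne (hat _), Function.update_of_ne (hbt _)]
    rw [dotProduct, Fin.sum_univ_def]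
    rfl
  rw [addInnerProduct, circuitUnitary_cons, circuitUnitary_append, circuitUnitary_cons,
    circuitUnitary_nil, hadamardGate_apply]
  simp only [innerPhase_apply, hadamardGate_apply, hsum, Function.update_self,
    Function.update_idem, sum_zmod_two, smul_add, smul_smul]
  rcases zmod_two_cases (x t) with h1 | h1 <;>
    rcases zmod_two_cases ((x ∘ a) ⬝ᵥ (x ∘ b)) with h2 | h2 <;>
    simp only [h1, h2, mul_zero, mul_one, bitSign_zero, bitSign_one, mul_neg, neg_mul,
      neg_neg, add_zero, zero_add, CharTwo.add_self_eq_zero]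
  all_goals
    have hc := inv_sqrt_two_mul_self
    generalize (((Real.sqrt 2)⁻¹ : ℝ) : ℂ) = c at hc ⊢
    match_scalars <;> first | (ring1) | linear_combination 2 * hc

end InnerProduct

/-! ### One step of the walk -/

section Walk

variable {m : ℕ} {W : Type*} [NormedAddCommGroup W] [InnerProductSpace ℂ W]

/-- The ancilla that holds the parity of the counter. -/
abbrev parityQubit {m : ℕ} : Qubit m 2 := Qubit.anc 0

/-- The ancilla that holds the inner product of `B` and `A`. -/
abbrev productQubit {m : ℕ} : Qubit m 2 := Qubit.anc 1

/-- The circuit that adds the inner product of `B` and `A` to an ancilla. -/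
noncomputable def computeProduct (m : ℕ) : List (Gate (Qubit m 2)) :=
  addInnerProduct Qubit.B Qubit.A productQubit (by simp) (by simp) (by simp)

/-- The circuit that moves the counter by one, in the direction given by the sum of the parity
qubit and the product qubit. -/
def moveCounter (m : ℕ) : List (Gate (Qubit m 2)) :=
  [diagonalGate productQubit Qubit.ctrl (by simp) (fun y z => bitSign ((1 + y) * z))
      (fun y z => by rw [star_bitSign, bitSign_mul_self]),
    diagonalGate productQubit parityQubit (by simp) (fun _ z => bitSign z)
      (fun y z => by rw [star_bitSign, bitSign_mul_self]),
    .nonzeroTest Qubit.ctrl, cnotGate parityQubit productQubit (by simp),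
    .increment productQubit, notGate productQubit, .decrement productQubit, notGate productQubit,
    cnotGate parityQubit productQubit (by simp), notGate parityQubit]

/-- A step of the walk on the counter. -/
noncomputable def walkStep (m : ℕ) : List (Gate (Qubit m 2)) :=
  computeProduct m ++ (moveCounter m ++ computeProduct m)

/-- The position from which the walk with answer bit `f` arrives at `n`. -/
def walkSource (f : ZMod 2) (n : ℤ) : ℤ := if f + (n : ZMod 2) = 0 then n - 1 else n + 1

/-- The phase collected by the walk with answer bit `f` when it leaves `n`. -/
def walkPhase (f : ZMod 2) (n : ℤ) : ℂ := bitSign ((1 + f) * nonzeroBit n + (n : ZMod 2))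

/-- The family of vectors with content `F b n` when `B` holds `b` and the counter holds `n`; the
control qubit is the function `c` of the counter. -/
def walkFamily (c : ℤ → ZMod 2) (F : Bits (Fin m) → ℤ → Bits (Fin m) → W) :
    Config (Qubit m 2) → W := fun s =>
  if s.1 Qubit.ctrl = c s.2 ∧ s.1 parityQubit = s.2 ∧ s.1 productQubit = 0 then
    F (s.1 ∘ Qubit.B) s.2 (s.1 ∘ Qubit.A) else 0

/-- The output is evaluated at a configuration by running the gates backwards, so `x` and `n`
describe the arrival and `n'` the departure. The test of the counter precedes the move, hence it
refers to `n'`. -/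
lemma moveCounter_apply (ψ : StateSpace (Qubit m 2) W) (x : Bits (Qubit m 2)) (n n' : ℤ)
    (hn : n' = if x productQubit + x parityQubit = 0 then n - 1 else n + 1) :
    circuitUnitary W (moveCounter m) ψ (x, n) =
      bitSign ((1 + x productQubit) * (x Qubit.ctrl + nonzeroBit n') + (x parityQubit + 1)) •
      ψ (Function.update (Function.update x Qubit.ctrl (x Qubit.ctrl + nonzeroBit n')) parityQubit
        (x parityQubit + 1), n') := by
  have h10 : (productQubit : Qubit m 2) ≠ parityQubit := by simp
  have h1c : (productQubit : Qubit m 2) ≠ Qubit.ctrl := by simp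
  have h0c : (parityQubit : Qubit m 2) ≠ Qubit.ctrl := by simp
  -- The pair of controlled moves, with negations around the second, shifts the counter up when its
  -- control bit is 1 and down when it is 0. The parity on departure is `x parityQubit + 1`.
  have hn2 : (if x productQubit + (x parityQubit + 1) = 1 then
      (if x productQubit + (x parityQubit + 1) + 1 = 1 then n + 1 else n) - 1
      else if x productQubit + (x parityQubit + 1) + 1 = 1 then n + 1 else n) = n' := by
    rw [hn]
    rcases zmod_two_cases (x productQubit) with h1 | h1 <;>
      rcases zmod_two_cases (x parityQubit) with h2 | h2 <;>
      simp [h1, h2, CharTwo.add_self_eq_zero]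
  have cancel_one : ∀ y : ZMod 2, y + 1 + 1 = y := by decide
  have cancel : ∀ y z : ZMod 2, y + z + z = y := by decide
  simp only [moveCounter, circuitUnitary_cons, circuitUnitary_nil, cnotGate_apply, notGate_apply,
    increment_apply, decrement_apply, nonzeroTest_apply, diagonalGate_apply, Function.update_self,
    Function.update_of_ne h10, Function.update_of_ne h10.symm, Function.update_of_ne h1c,
    Function.update_of_ne h1c.symm, Function.update_of_ne h0c, Function.update_of_ne h0c.symm,
    Function.update_idem, smul_smul]
  rw [cancel_one, cancel, hn2, ← bitSign_add, Function.update_comm h10.symm,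
    Function.update_eq_self, Function.update_comm h0c.symm, add_comm]

/-- Neither `A` nor `B` is changed by the move, so the second evaluation of the inner product clears
the product qubit. The control qubit is cleared by the test made before the counter moves, and the
parity qubit is flipped along with the parity of the counter. -/
lemma walkStep_apply (ψ : StateSpace (Qubit m 2) W)
    (F : Bits (Fin m) → ℤ → Bits (Fin m) → W)
    (hψ : (ψ : Config (Qubit m 2) → W) = walkFamily nonzeroBit F) :
    (circuitUnitary W (walkStep m) ψ : Config (Qubit m 2) → W) =
      walkFamily 0 fun b n a => walkPhase (b ⬝ᵥ a) (walkSource (b ⬝ᵥ a) n) •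
        F b (walkSource (b ⬝ᵥ a) n) a := by
  have h10 : (productQubit : Qubit m 2) ≠ parityQubit := by simp
  have h1c : (productQubit : Qubit m 2) ≠ Qubit.ctrl := by simp
  have h0c : (parityQubit : Qubit m 2) ≠ Qubit.ctrl := by simp
  funext ⟨x, n⟩
  have hB : ∀ (y : Bits (Qubit m 2)) (j : Unit ⊕ Fin 2) z,
      Function.update y (.inr (.inr j)) z ∘ Qubit.B = y ∘ Qubit.B := by
    intro y j z
    funext i
    simp
  have hA : ∀ (y : Bits (Qubit m 2)) (j : Unit ⊕ Fin 2) z,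
      Function.update y (.inr (.inr j)) z ∘ Qubit.A = y ∘ Qubit.A := by
    intro y j z
    funext i
    simp
  rw [walkStep, circuitUnitary_append, circuitUnitary_append, computeProduct,
    addInnerProduct_apply, moveCounter_apply _ _ _ _ rfl, addInnerProduct_apply, hψ]
  simp only [walkFamily, hB, hA, Function.update_self, Function.update_of_ne h10,
    Function.update_of_ne h10.symm, Function.update_of_ne h1c, Function.update_of_ne h1c.symm,
    Function.update_of_ne h0c.symm]
  set b := x ∘ Qubit.B
  set a := x ∘ Qubit.A
  set f := b ⬝ᵥ a
  set n' := if x productQubit + f + x parityQubit = 0 then n - 1 else n + 1 with hn'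
  have hcast : (n' : ZMod 2) = n + 1 := by
    rw [hn']
    split_ifs
    · rw [Int.cast_sub, Int.cast_one, CharTwo.sub_eq_add]
    · rw [Int.cast_add, Int.cast_one]
  -- The departure configuration is in the support with control qubit `nonzeroBit` exactly when the
  -- arrival configuration is in the support with control qubit 0.
  have hc : (x Qubit.ctrl + nonzeroBit n' = nonzeroBit n' ∧ x parityQubit + 1 = (n' : ZMod 2) ∧
      x productQubit + f + f = 0) ↔
      (x Qubit.ctrl = (0 : ℤ → ZMod 2) n ∧ x parityQubit = (n : ZMod 2) ∧ x productQubit = 0) := by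
    rw [hcast, add_left_inj, add_eq_right, add_assoc, CharTwo.add_self_eq_zero, add_zero]
    rfl
  simp only [hc]
  by_cases h : x Qubit.ctrl = (0 : ℤ → ZMod 2) n ∧ x parityQubit = (n : ZMod 2) ∧
      x productQubit = 0
  · rw [if_pos h]
    refine Eq.trans ?_ (if_pos h).symm
    have hs : n' = walkSource f n := by
      rw [hn', h.2.1, h.2.2, zero_add]
      rfl
    rw [h.2.2, h.1, h.2.1, ← hcast, hs, zero_add, Pi.zero_apply, zero_add]
    rfl
  · rw [if_neg h, smul_zero]
    exact (if_neg h).symm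

end Walk

/-! ### The stationary amplitudes of the walk -/

section Amplitudes

/-- The amplitudes `w ^ k` for `k ≥ 0`. -/
def rightAmplitude (w : ℝ) (k : ℤ) : ℝ := if 0 ≤ k then w ^ k.toNat else 0

/-- The amplitudes `w ^ (-k - 1)` for `k < 0`. -/
def leftAmplitude (w : ℝ) (k : ℤ) : ℝ := if k < 0 then w ^ (-k - 1).toNat else 0

/-- The geometric sequence obeys a homogeneous recurrence except for a unit source at `k = 0`. This
source, and the one in `leftAmplitude_eq`, are what balance the public amplitude at the origin. -/
lemma rightAmplitude_eq (w : ℝ) (k : ℤ) :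
    rightAmplitude w k = w * rightAmplitude w (k - 1) + if k = 0 then 1 else 0 := by
  unfold rightAmplitude
  rcases lt_trichotomy k 0 with h | rfl | h
  · simp [h.not_ge, h.ne, show ¬ 1 ≤ k by omega]
  · simp
  · rw [if_pos h.le, if_pos (by omega), if_neg h.ne', add_zero, ← pow_succ']
    congr 1
    omega

lemma leftAmplitude_eq (w : ℝ) (k : ℤ) :
    leftAmplitude w (k - 1) = w * leftAmplitude w k + if k = 0 then 1 else 0 := by
  unfold leftAmplitude
  rcases lt_trichotomy k 0 with h | rfl | h
  · rw [if_pos h, if_pos (by omega), if_neg h.ne, add_zero, ← pow_succ']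
    congr 1
    omega
  · simp
  · simp [h.not_gt, h.ne', show ¬ k < 1 by omega]

/-- The amplitudes of the part of the catalyst that the oracle fixes. The bit `s` is the majority
answer, and `w` the ratio of the probabilities of the two answers. -/
def fixedAmplitude (s : ZMod 2) (w : ℝ) (n : ℤ) : ℝ :=
  if s = 0 then
    if Even n then w * rightAmplitude w (n / 2 - 1) else leftAmplitude w (n / 2)
  else
    if Even n then -(w * leftAmplitude w (n / 2)) else rightAmplitude w (n / 2)

/-- The amplitudes of the part of the catalyst that the oracle negates. -/
def negatedAmplitude (s : ZMod 2) (w : ℝ) (n : ℤ) : ℝ :=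
  if s = 0 then
    if Even n then leftAmplitude w (n / 2) else -rightAmplitude w (n / 2)
  else
    if Even n then rightAmplitude w (n / 2 - 1) else leftAmplitude w (n / 2)

/-- The vector that the oracle negates, as a function of the answer bit. -/
def negatedVector (s : ZMod 2) (w : ℝ) (f : ZMod 2) : ℝ :=
  if s = 0 then (if f = 0 then w else -1) else (if f = 0 then 1 else -w)

lemma fixedAmplitude_even (s : ZMod 2) (w : ℝ) (k : ℤ) : fixedAmplitude s w (2 * k) =
    if s = 0 then w * rightAmplitude w (k - 1) else -(w * leftAmplitude w k) := by
  simp [fixedAmplitude]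

lemma fixedAmplitude_odd (s : ZMod 2) (w : ℝ) (k : ℤ) : fixedAmplitude s w (2 * k + 1) =
    if s = 0 then leftAmplitude w k else rightAmplitude w k := by
  have h : (2 * k + 1) / 2 = k := by omega
  have hk : ¬ Even (2 * k + 1) := Int.not_even_iff_odd.2 ⟨k, rfl⟩
  simp [hk, fixedAmplitude, h]

lemma negatedAmplitude_even (s : ZMod 2) (w : ℝ) (k : ℤ) : negatedAmplitude s w (2 * k) =
    if s = 0 then leftAmplitude w k else rightAmplitude w (k - 1) := by
  simp [negatedAmplitude]

lemma negatedAmplitude_odd (s : ZMod 2) (w : ℝ) (k : ℤ) : negatedAmplitude s w (2 * k + 1) =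
    if s = 0 then -rightAmplitude w k else leftAmplitude w k := by
  have h : (2 * k + 1) / 2 = k := by omega
  have hk : ¬ Even (2 * k + 1) := Int.not_even_iff_odd.2 ⟨k, rfl⟩
  simp [hk, negatedAmplitude, h]

/-- With `negatedAmplitude_zero`, this makes the catalyst vanish wherever the counter is 0, hence
orthogonal to the public space. -/
lemma fixedAmplitude_zero (s : ZMod 2) (w : ℝ) : fixedAmplitude s w 0 = 0 := by
  simp [fixedAmplitude, rightAmplitude, leftAmplitude]

lemma negatedAmplitude_zero (s : ZMod 2) (w : ℝ) : negatedAmplitude s w 0 = 0 := by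
  simp [negatedAmplitude, rightAmplitude, leftAmplitude]

/-- The step of the walk, after a query, sends the stationary amplitudes with the initial state at
the origin to the same amplitudes with the final state at the origin. -/
lemma walkPhase_mul_amplitude (s : ZMod 2) (w : ℝ) (f : ZMod 2) (n : ℤ) :
    walkPhase f (walkSource f n) *
      ((fixedAmplitude s w (walkSource f n) -
        negatedAmplitude s w (walkSource f n) * negatedVector s w f +
          if walkSource f n = 0 then 1 else 0 : ℝ) : ℂ) =
      ((fixedAmplitude s w n + negatedAmplitude s w n * negatedVector s w f : ℝ) : ℂ) +
        if n = 0 then bitSign s else 0 := by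
  have two : (2 : ZMod 2) = 0 := rfl
  -- The even position `2k` is reached from `2k - 1` with answer 0 and from `2k + 1` with answer 1;
  -- the odd position `2k + 1` from `2k + 2` and from `2k`, respectively. The recurrence of the left
  -- amplitudes settles answer 0, that of the right amplitudes answer 1.
  obtain ⟨k, rfl | rfl⟩ := Int.even_or_odd' n
  · have hr := rightAmplitude_eq w k
    have hl := leftAmplitude_eq w k
    rcases zmod_two_cases f with rfl | rfl
    · have hs : walkSource 0 (2 * k) = 2 * (k - 1) + 1 := by
        simp [walkSource, two]
        ring
      have hz : 2 * (k - 1) + 1 ≠ 0 := by omega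
      rw [hs, walkPhase, fixedAmplitude_even, fixedAmplitude_odd, negatedAmplitude_even,
        negatedAmplitude_odd, hl]
      rcases zmod_two_cases s with rfl | rfl <;> by_cases hk : k = 0 <;>
        simp [nonzeroBit, hz, hk, two, negatedVector, CharTwo.add_self_eq_zero] <;> ring
    · have hs : walkSource 1 (2 * k) = 2 * k + 1 := by
        simp [walkSource, two]
      have hz : 2 * k + 1 ≠ 0 := by omega
      rw [hs, walkPhase, fixedAmplitude_even, fixedAmplitude_odd, negatedAmplitude_even,
        negatedAmplitude_odd, hr]
      rcases zmod_two_cases s with rfl | rfl <;> by_cases hk : k = 0 <;>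
        simp [nonzeroBit, hz, hk, two, negatedVector, CharTwo.add_self_eq_zero] <;> ring
  · have hz : 2 * k + 1 ≠ 0 := by omega
    rcases zmod_two_cases f with rfl | rfl
    · have hs : walkSource 0 (2 * k + 1) = 2 * (k + 1) := by
        simp [walkSource, two]
        ring
      have hl := leftAmplitude_eq w (k + 1)
      rw [add_sub_cancel_right] at hl
      rw [hs, walkPhase, fixedAmplitude_even, fixedAmplitude_odd, negatedAmplitude_even,
        negatedAmplitude_odd, hl, add_sub_cancel_right]
      -- This is the case in which the departure point `2 * (k + 1)` is the origin.
      by_cases hk : k = -1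
      · subst hk
        rcases zmod_two_cases s with rfl | rfl <;>
          simp [nonzeroBit, negatedVector, rightAmplitude, leftAmplitude]
      · have hk' : k + 1 ≠ 0 := by omega
        rcases zmod_two_cases s with rfl | rfl <;>
          simp [nonzeroBit, hz, hk', two, negatedVector] <;> ring
    · have hs : walkSource 1 (2 * k + 1) = 2 * k := by
        simp [walkSource, two, CharTwo.add_self_eq_zero]
      have hr := rightAmplitude_eq w k
      rw [hs, walkPhase, fixedAmplitude_even, fixedAmplitude_odd, negatedAmplitude_even,
        negatedAmplitude_odd, hr]
      rcases zmod_two_cases s with rfl | rfl <;> by_cases hk : k = 0 <;>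
        simp [nonzeroBit, hz, hk, two, negatedVector, CharTwo.add_self_eq_zero] <;> ring

/-- The positive odd, positive even, negative odd and negative even positions give four geometric
series of ratio `w ^ 2`. Their leading coefficients are `w, w ^ 2, 1, w` if `s = 0` and `1, w, w, w
^ 2` if `s = 1`. In both cases they add up to `(1 + w) ^ 2`, and `(1 + w) ^ 2 / (1 - w ^ 2) = (1 +
w) / (1 - w)`. -/
lemma hasSum_amplitude_sq (s : ZMod 2) {w : ℝ} (hw0 : 0 ≤ w) (hw1 : w < 1) :
    HasSum (fun n => fixedAmplitude s w n ^ 2 + w * negatedAmplitude s w n ^ 2)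
      ((1 + w) / (1 - w)) := by
  set e : ℤ → ℝ := fun n => fixedAmplitude s w n ^ 2 + w * negatedAmplitude s w n ^ 2 with he
  have hw2 : w ^ 2 < 1 := by nlinarith
  have hg : HasSum (fun j : ℕ => (w ^ 2) ^ j) (1 - w ^ 2)⁻¹ :=
    hasSum_geometric_of_lt_one (sq_nonneg w) hw2
  have hpow : ∀ j : ℕ, (w ^ j) ^ 2 = (w ^ 2) ^ j := fun j => by rw [← pow_mul, ← pow_mul, mul_comm]
  have hrn : ∀ j : ℕ, rightAmplitude w j = w ^ j := fun j => by simp [rightAmplitude]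
  have hln : ∀ j : ℕ, leftAmplitude w j = 0 := fun j => by simp [leftAmplitude]
  have hrz : ∀ j : ℕ, rightAmplitude w (-(j : ℤ) - 1) = 0 := fun j => by
    rw [rightAmplitude, if_neg (by omega)]
  have hlz : ∀ j : ℕ, leftAmplitude w (-(j : ℤ) - 1) = w ^ j := fun j => by
    rw [leftAmplitude, if_pos (by omega)]
    congr 1
    omega
  have hl1 : ∀ j : ℕ, leftAmplitude w (j + 1) = 0 := fun j => by exact_mod_cast hln (j + 1)
  have hr2 : ∀ j : ℕ, rightAmplitude w (-(j : ℤ) - 1 - 1) = 0 := fun j => by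
    rw [rightAmplitude, if_neg (by omega)]
  have h1 : ∀ j : ℕ, e ((2 * j : ℕ) + 1) = (if s = 0 then w else 1) * (w ^ 2) ^ j := fun j => by
    simp only [he, Nat.cast_mul, Nat.cast_ofNat, fixedAmplitude_odd, negatedAmplitude_odd, hrn, hln]
    split_ifs <;> rw [← hpow] <;> ring
  have h2 : ∀ j : ℕ, e ((2 * j + 1 : ℕ) + 1) = (if s = 0 then w ^ 2 else w) * (w ^ 2) ^ j :=
    fun j => by
      have hn : ((2 * j + 1 : ℕ) : ℤ) + 1 = 2 * (j + 1) := by push_cast; ring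
      simp only [he, hn, fixedAmplitude_even, negatedAmplitude_even, add_sub_cancel_right, hrn, hl1]
      split_ifs <;> rw [← hpow] <;> ring
  have h3 : ∀ j : ℕ, e (-(((2 * j : ℕ) : ℤ) + 1)) = (if s = 0 then 1 else w) * (w ^ 2) ^ j :=
    fun j => by
      have hn : -(((2 * j : ℕ) : ℤ) + 1) = 2 * (-(j : ℤ) - 1) + 1 := by push_cast; ring
      simp only [he, hn, fixedAmplitude_odd, negatedAmplitude_odd, hrz, hlz]
      split_ifs <;> rw [← hpow] <;> ring
  have h4 : ∀ j : ℕ, e (-(((2 * j + 1 : ℕ) : ℤ) + 1)) = (if s = 0 then w else w ^ 2) * (w ^ 2) ^ j :=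
    fun j => by
      have hn : -(((2 * j + 1 : ℕ) : ℤ) + 1) = 2 * (-(j : ℤ) - 1) := by push_cast; ring
      simp only [he, hn, fixedAmplitude_even, negatedAmplitude_even, hr2, hlz]
      split_ifs <;> rw [← hpow] <;> ring
  have hpos : HasSum (fun n : ℕ => e (n + 1)) _ :=
    HasSum.even_add_odd (f := fun n : ℕ => e (n + 1)) ((hg.mul_left _).congr_fun h1)
      ((hg.mul_left _).congr_fun h2)
  have hneg : HasSum (fun n : ℕ => e (-(n + 1))) _ :=
    HasSum.even_add_odd (f := fun n : ℕ => e (-(n + 1))) ((hg.mul_left _).congr_fun h3)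
      ((hg.mul_left _).congr_fun h4)
  have h := hpos.of_add_one_of_neg_add_one hneg
  have h0 : e 0 = 0 := by simp [he, fixedAmplitude_zero, negatedAmplitude_zero]
  convert h using 1
  have hne : 1 - w ≠ 0 := by linarith
  have hne' : 1 + w ≠ 0 := by linarith
  have hne2 : 1 - w ^ 2 = (1 - w) * (1 + w) := by ring
  rw [h0, hne2]
  split_ifs <;> field_simp <;> ring

end Amplitudes

/-! ### Hadamard operations on the register `B` -/

section HadamardLayer

variable {m : ℕ} {W : Type*} [NormedAddCommGroup W] [InnerProductSpace ℂ W]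

/-- The Hadamard operations on the listed qubits of `B`. -/
noncomputable def hadamardLayer {m : ℕ} (l : List (Fin m)) : List (Gate (Qubit m 2)) :=
  l.map fun i => hadamardGate (Qubit.B i)

/-- Each gate is its own inverse; with the order reversed, the gates cancel in pairs from the inside
and no commutation is needed. -/
lemma hadamardLayer_reverse_apply (l : List (Fin m)) (ψ : StateSpace (Qubit m 2) W) :
    circuitUnitary W (hadamardLayer l.reverse) (circuitUnitary W (hadamardLayer l) ψ) = ψ := by
  induction l generalizing ψ with
  | nil => rfl
  | cons i l ih =>
    have h : hadamardLayer (i :: l).reverse =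
        hadamardLayer l.reverse ++ [hadamardGate (Qubit.B i)] := by simp [hadamardLayer]
    have h' : hadamardLayer (i :: l) = hadamardGate (Qubit.B i) :: hadamardLayer l := rfl
    rw [h, h', circuitUnitary_append, circuitUnitary_cons (l := hadamardLayer l), ih,
      circuitUnitary_cons, circuitUnitary_nil, hadamardGate_involutive]

/-- The amplitude of a basis state of `B` in the state obtained from `|r⟩` by Hadamard operations
on the qubits in `S`. -/
noncomputable def hadamardAmplitude (S : Finset (Fin m)) (r b : Bits (Fin m)) : ℂ :=
  ∏ i, if i ∈ S then (((Real.sqrt 2)⁻¹ : ℝ) : ℂ) * bitSign (b i * r i)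
    else if b i = r i then 1 else 0

lemma hadamardAmplitude_insert (S : Finset (Fin m)) (j : Fin m) (hj : j ∉ S)
    (r b : Bits (Fin m)) :
    (((Real.sqrt 2)⁻¹ : ℝ) : ℂ) *
        ∑ z, bitSign (b j * z) * hadamardAmplitude S r (Function.update b j z) =
      hadamardAmplitude (insert j S) r b := by
  have h : ∀ z, hadamardAmplitude S r (Function.update b j z) = (if z = r j then 1 else 0) *
      ∏ i ∈ Finset.univ.erase j, if i ∈ insert j S then
        (((Real.sqrt 2)⁻¹ : ℝ) : ℂ) * bitSign (b i * r i) else if b i = r i then 1 else 0 := by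
    intro z
    rw [hadamardAmplitude, ← Finset.mul_prod_erase _ _ (Finset.mem_univ j), if_neg hj,
      Function.update_self]
    congr 1
    refine Finset.prod_congr rfl fun i hi => ?_
    have hij := Finset.ne_of_mem_erase hi
    simp only [Function.update_of_ne hij, Finset.mem_insert, hij, false_or]
  simp only [h]
  rw [hadamardAmplitude, ← Finset.mul_prod_erase _ _ (Finset.mem_univ j),
    if_pos (Finset.mem_insert_self j S), mul_assoc]
  simp only [← mul_assoc, ← Finset.sum_mul]
  simp [mul_assoc]

lemma hadamardAmplitude_univ (r b : Bits (Fin m)) :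
    hadamardAmplitude Finset.univ r b =
      (((Real.sqrt 2)⁻¹ ^ m : ℝ) : ℂ) * bitSign (b ⬝ᵥ r) := by
  simp only [hadamardAmplitude, Finset.mem_univ, if_true, Finset.prod_mul_distrib]
  rw [dotProduct, bitSign_sum]
  simp

/-- `S` is the set of qubits of `B` already transformed. Generalizing over it makes the induction
work, with `hadamardAmplitude_insert` as its step; the factor `G` does not depend on `B` and is
carried along. -/
lemma hadamardLayer_apply (l : List (Fin m)) (hl : l.Nodup) (S : Finset (Fin m))
    (hS : ∀ i ∈ l, i ∉ S) (r : Bits (Fin m)) (ψ : StateSpace (Qubit m 2) W)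
    (G : Config (Qubit m 2) → W)
    (hG : ∀ x n (i : Fin m) z, G (Function.update x (Qubit.B i) z, n) = G (x, n))
    (hψ : ∀ x n, ψ (x, n) = hadamardAmplitude S r (x ∘ Qubit.B) • G (x, n))
    (x : Bits (Qubit m 2)) (n : ℤ) :
    circuitUnitary W (hadamardLayer l) ψ (x, n) =
      hadamardAmplitude (S ∪ l.toFinset) r (x ∘ Qubit.B) • G (x, n) := by
  induction l generalizing S ψ with
  | nil => simpa [hadamardLayer, circuitUnitary_nil] using hψ x n
  | cons j l ih =>
    have h' : hadamardLayer (j :: l) = hadamardGate (Qubit.B j) :: hadamardLayer l := rfl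
    have hj := hS j (by simp)
    rw [h', circuitUnitary_cons, ih (List.nodup_cons.1 hl).2 (insert j S), List.toFinset_cons,
      Finset.insert_union, Finset.union_insert]
    · intro i hi h
      rcases Finset.mem_insert.1 h with rfl | h
      · exact (List.nodup_cons.1 hl).1 hi
      · exact hS i (List.mem_cons_of_mem _ hi) h
    · intro x n
      have hB : ∀ z, Function.update x (Qubit.B j) z ∘ Qubit.B =
          Function.update (x ∘ Qubit.B) j z := by
        intro z
        funext i
        by_cases hij : i = j
        · subst hij
          simp
        · simp [hij]
      rw [hadamardGate_apply]
      simp only [hψ, hG, hB, smul_smul]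
      rw [← Finset.sum_smul, smul_smul, ← hadamardAmplitude_insert S j hj]
      rfl

/-- This is the starting point `S = ∅` of the induction over Hadamard operations: the amplitude is
then the indicator of `r`. -/
lemma publicState_apply (r : Bits (Fin m)) (Φ : QubitsTensor m W) (x : Bits (Qubit m 2)) (n : ℤ) :
    publicState 2 r Φ (x, n) = hadamardAmplitude ∅ r (x ∘ Qubit.B) •
      walkFamily 0 (fun _ n a => if n = 0 then Φ a else 0) (x, n) := by
  have h1 : publicState 2 r Φ (x, n) =
      ∑ a, if (x, n) = basisConfig 2 r a then Φ a else 0 := by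
    rw [publicState, lp.coeFn_sum, Finset.sum_apply]
    refine Finset.sum_congr rfl fun a _ => ?_
    rw [lp.single_apply]
    split_ifs with h
    · rw [h, Pi.single_eq_same]
    · exact Pi.single_eq_of_ne h _
  have h2 : ∀ a, (x, n) = basisConfig 2 r a ↔
      a = x ∘ Qubit.A ∧ (x ∘ Qubit.B = r ∧ n = 0 ∧ x Qubit.ctrl = 0 ∧ x parityQubit = 0 ∧
        x productQubit = 0) := by
    intro a
    simp only [basisConfig, Prod.mk.injEq, funext_iff, Sum.forall, Fin.forall_fin_two,
      Function.comp_apply, Sum.elim_inl, Sum.elim_inr, Pi.zero_apply]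
    constructor
    · rintro ⟨⟨h1, h2, h3, h4, h5⟩, h6⟩
      exact ⟨fun i => (h2 i).symm, h1, h6, h3 (), h4, h5⟩
    · rintro ⟨h2, h1, h6, h3, h4, h5⟩
      exact ⟨⟨h1, fun i => (h2 i).symm, fun _ => h3, h4, h5⟩, h6⟩
  have h3 : hadamardAmplitude ∅ r (x ∘ Qubit.B) = if x ∘ Qubit.B = r then 1 else 0 := by
    simp only [hadamardAmplitude, Finset.notMem_empty, if_false, Finset.prod_ite_zero,
      Finset.prod_const_one, funext_iff, Finset.mem_univ, true_imp_iff]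
  rw [h1, h3]
  simp only [h2, ite_and, Finset.sum_ite_eq', Finset.mem_univ, if_true, walkFamily]
  by_cases hb : x ∘ Qubit.B = r
  · by_cases hn : n = 0
    · subst hn
      simp [hb]
    · simp [hn]
  · simp [hb]

/-- The Hadamard operations turn `|r⟩` into the superposition of all basis states of `B` with the
signs given by the inner product with `r`. -/
lemma hadamardLayer_publicState (r : Bits (Fin m)) (Φ : QubitsTensor m W) :
    (circuitUnitary W (hadamardLayer (List.finRange m)) (publicState 2 r Φ) :
      Config (Qubit m 2) → W) = walkFamily 0 fun b n a =>
        if n = 0 then ((((Real.sqrt 2)⁻¹ ^ m : ℝ) : ℂ) * bitSign (b ⬝ᵥ r)) • Φ a else 0 := by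
  funext ⟨x, n⟩
  rw [hadamardLayer_apply (List.finRange m) (List.nodup_finRange m) ∅ (by simp) r _ _ _
    (publicState_apply r Φ)]
  · have : ∅ ∪ (List.finRange m).toFinset = Finset.univ := by
      ext i
      simp
    rw [this, hadamardAmplitude_univ]
    simp only [walkFamily, smul_ite, smul_zero]
  · intro x n i z
    have hA : Function.update x (Qubit.B i) z ∘ Qubit.A = x ∘ Qubit.A := by
      funext j
      simp
    simp [walkFamily, hA]

/-- The family vanishes on the configurations of the public space. -/
def VanishesOnPublic (ψ : Config (Qubit m 2) → W) : Prop :=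
  ∀ s, s.2 = 0 ∧ s.1 Qubit.ctrl = 0 ∧ (∀ i, s.1 (Qubit.anc i) = 0) → ψ s = 0

lemma VanishesOnPublic.hadamardLayer {ψ : StateSpace (Qubit m 2) W}
    (hψ : VanishesOnPublic (ψ : Config (Qubit m 2) → W)) (l : List (Fin m)) :
    VanishesOnPublic (circuitUnitary W (hadamardLayer l) ψ : Config (Qubit m 2) → W) := by
  induction l generalizing ψ with
  | nil => exact hψ
  | cons i l ih =>
    have h' : _root_.hadamardLayer (i :: l) =
      hadamardGate (Qubit.B i) :: _root_.hadamardLayer l := rfl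
    rw [h', circuitUnitary_cons]
    refine ih fun ⟨x, n⟩ hs => ?_
    rw [hadamardGate_apply]
    have h : ∀ z, ψ (Function.update x (Qubit.B i) z, n) = 0 := fun z => hψ _ (by simpa using hs)
    simp [h]

lemma VanishesOnPublic.mem_orthogonal {ψ : StateSpace (Qubit m 2) W}
    (hψ : VanishesOnPublic (ψ : Config (Qubit m 2) → W)) : ψ ∈ (publicSpace m 2 W)ᗮ := by
  rw [Submodule.mem_orthogonal]
  intro u hu
  rw [lp.inner_eq_tsum]
  refine (tsum_congr fun s => ?_).trans tsum_zero
  by_cases hs : s.2 = 0 ∧ s.1 Qubit.ctrl = 0 ∧ ∀ i, s.1 (Qubit.anc i) = 0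
  · rw [hψ s hs, inner_zero_right]
  · rw [hu s hs, inner_zero_left]

lemma publicState_mem (r : Bits (Fin m)) (Φ : QubitsTensor m W) :
    publicState 2 r Φ ∈ publicSpace m 2 W := by
  rintro ⟨x, n⟩ hs
  rw [publicState_apply, walkFamily]
  by_cases hn : n = 0
  · subst hn
    rw [if_neg, smul_zero]
    rintro ⟨h1, h2, h3⟩
    exact hs ⟨rfl, h1, Fin.forall_fin_two.2 ⟨by simpa using h2, h3⟩⟩
  · simp [hn]

end HadamardLayer

/-! ### Norms and queries of walk families -/

section WalkFamily

open scoped ENNReal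

variable {m : ℕ} {W : Type*} [NormedAddCommGroup W] [InnerProductSpace ℂ W]

/-- The configuration with given contents of `B`, `A`, the control qubit, and the counter, with
the parity qubit holding the parity of the counter. -/
def walkConfig (c : ℤ → ZMod 2) (s : Bits (Fin m) × ℤ × Bits (Fin m)) : Config (Qubit m 2) :=
  (Sum.elim s.1 (Sum.elim s.2.2 (Sum.elim (fun _ => c s.2.1) ![(s.2.1 : ZMod 2), 0])), s.2.1)

lemma walkConfig_injective (c : ℤ → ZMod 2) :
    Function.Injective (walkConfig c : Bits (Fin m) × ℤ × Bits (Fin m) → _) := by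
  rintro ⟨b, n, a⟩ ⟨b', n', a'⟩ h
  have hn : n = n' := congrArg Prod.snd h
  have hb : b = b' := funext fun i => congrFun (congrArg Prod.fst h) (Qubit.B i)
  have ha : a = a' := funext fun i => congrFun (congrArg Prod.fst h) (Qubit.A i)
  rw [hn, hb, ha]

omit [InnerProductSpace ℂ W] in
lemma walkFamily_walkConfig (c : ℤ → ZMod 2) (F : Bits (Fin m) → ℤ → Bits (Fin m) → W)
    (s : Bits (Fin m) × ℤ × Bits (Fin m)) :
    walkFamily c F (walkConfig c s) = F s.1 s.2.1 s.2.2 :=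
  if_pos ⟨rfl, rfl, rfl⟩

omit [InnerProductSpace ℂ W] in
-- Working with extended non-negative sums, one computation gives both square-summability, which is
-- needed to have the catalyst as a state, and the value of its norm.
lemma energy_walkFamily (c : ℤ → ZMod 2) (F : Bits (Fin m) → ℤ → Bits (Fin m) → W)
    (E : Bits (Fin m) → ℝ) (hE : ∀ b, HasSum (fun n => ∑ a, ‖F b n a‖ ^ 2) (E b)) :
    energy (walkFamily c F) = ENNReal.ofReal (∑ b, E b) := by
  have hsupp : Function.support (fun s => ‖walkFamily c F s‖ₑ ^ 2) ⊆ Set.range (walkConfig c) := by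
    rintro ⟨x, n⟩ hs
    by_contra h
    refine hs ?_
    have : walkFamily c F (x, n) = 0 := by
      refine if_neg fun hx => h ⟨(x ∘ Qubit.B, n, x ∘ Qubit.A), ?_⟩
      refine Prod.ext (funext ?_) rfl
      rintro (i | i | i | i)
      · rfl
      · rfl
      · exact hx.1.symm
      · fin_cases i
        · exact hx.2.1.symm
        · exact hx.2.2.symm
    simp [this]
  rw [energy, ← (walkConfig_injective c).tsum_eq hsupp, ENNReal.tsum_prod', tsum_fintype,
    ENNReal.ofReal_sum_of_nonneg fun b _ => (hE b).nonneg fun n => by positivity]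
  refine Finset.sum_congr rfl fun b _ => ?_
  rw [ENNReal.tsum_prod', ← (hE b).tsum_eq,
    ENNReal.ofReal_tsum_of_nonneg (fun n => by positivity) (hE b).summable]
  refine tsum_congr fun n => ?_
  rw [tsum_fintype, ENNReal.ofReal_sum_of_nonneg fun a _ => by positivity]
  refine Finset.sum_congr rfl fun a _ => ?_
  rw [walkFamily_walkConfig, ENNReal.ofReal_pow (norm_nonneg _), ofReal_norm]

lemma nonzeroTest_walkFamily (ψ : StateSpace (Qubit m 2) W)
    (F : Bits (Fin m) → ℤ → Bits (Fin m) → W)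
    (hψ : (ψ : Config (Qubit m 2) → W) = walkFamily 0 F) :
    ((Gate.nonzeroTest Qubit.ctrl).unitary W ψ : Config (Qubit m 2) → W) =
      walkFamily nonzeroBit F := by
  funext ⟨x, n⟩
  rw [nonzeroTest_apply, hψ]
  have hB : Function.update x Qubit.ctrl (x Qubit.ctrl + nonzeroBit n) ∘ Qubit.B =
      x ∘ Qubit.B := by
    funext i
    simp
  have hA : Function.update x Qubit.ctrl (x Qubit.ctrl + nonzeroBit n) ∘ Qubit.A =
      x ∘ Qubit.A := by
    funext i
    simp
  have hc : x Qubit.ctrl + nonzeroBit n = 0 ↔ x Qubit.ctrl = nonzeroBit n := CharTwo.add_eq_zero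
  simp [walkFamily, hB, hA, hc]

/-- The control qubit is 1 exactly when the counter is non-zero, so only the origin escapes the
oracle. -/
lemma queryOp_walkFamily (O : Oracle m W) (ψ : StateSpace (Qubit m 2) W)
    (F : Bits (Fin m) → ℤ → Bits (Fin m) → W)
    (hψ : (ψ : Config (Qubit m 2) → W) = walkFamily nonzeroBit F) :
    (queryOp 2 O ψ : Config (Qubit m 2) → W) = walkFamily nonzeroBit fun b n a =>
      if n = 0 then F b n a else O (WithLp.toLp 2 (F b n)) a := by
  funext ⟨x, n⟩
  have hq : ∀ (y : Bits (Fin m)) (j : Unit ⊕ Fin 2),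
      Function.extend (regA m 2) y x (.inr (.inr j)) = x (.inr (.inr j)) := by
    intro y j
    rw [Function.extend_apply']
    rintro ⟨i, hi⟩
    have h : (Sum.inr (Sum.inl i) : Qubit m 2) = Sum.inr (Sum.inr j) := hi
    simp at h
  have hB : ∀ y : Bits (Fin m), Function.extend (regA m 2) y x ∘ Qubit.B = x ∘ Qubit.B := by
    intro y
    funext l
    rw [Function.comp_apply, Function.extend_apply']
    · rfl
    rintro ⟨i, hi⟩
    have h : (Sum.inr (Sum.inl i) : Qubit m 2) = Sum.inl l := hi
    simp at h
  have hA : ∀ y : Bits (Fin m), Function.extend (regA m 2) y x ∘ Qubit.A = y := fun y =>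
    Function.extend_comp (regA m 2).injective y x
  have hf : fiber (regA m 2) ψ (x, n) =
      if x Qubit.ctrl = nonzeroBit n ∧ x parityQubit = (n : ZMod 2) ∧ x productQubit = 0 then
        WithLp.toLp 2 (F (x ∘ Qubit.B) n) else 0 := by
    ext y
    rw [fiber, hψ]
    simp only [walkFamily, hq, hB, hA]
    split_ifs <;> rfl
  rw [queryOp, fiberUnitary_apply, hf]
  change _ = if x Qubit.ctrl = nonzeroBit n ∧ x parityQubit = (n : ZMod 2) ∧
    x productQubit = 0 then _ else _
  by_cases h : x Qubit.ctrl = nonzeroBit n ∧ x parityQubit = (n : ZMod 2) ∧ x productQubit = 0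
  · rw [if_pos h, if_pos h]
    by_cases hn : n = 0
    · have hc : x Qubit.ctrl ≠ 1 := by
        rw [h.1, nonzeroBit, if_pos hn]
        decide
      refine Eq.trans ?_ (if_pos hn).symm
      rw [if_neg hc]
      rfl
    · have hc : x Qubit.ctrl = 1 := by rw [h.1, nonzeroBit, if_neg hn]
      refine Eq.trans ?_ (if_neg hn).symm
      rw [if_pos hc]
      rfl
  · rw [if_neg h, if_neg h, map_zero]
    rfl

omit [InnerProductSpace ℂ W] in
lemma norm_sq_eq_tsum (ψ : StateSpace (Qubit m 2) W) : ‖ψ‖ ^ 2 = ∑' s, ‖ψ s‖ ^ 2 := by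
  have h := lp.norm_rpow_eq_tsum (p := 2) (by norm_num) ψ
  simpa only [ENNReal.toReal_ofNat, Real.rpow_ofNat] using h

omit [InnerProductSpace ℂ W] in
/-- If two states agree away from the origin, and the second vanishes at the origin, then the part
of the first one that is queried has the norm of the second one. -/
lemma queriedNormSq_walkFamily (ψ χ : StateSpace (Qubit m 2) W)
    (F G : Bits (Fin m) → ℤ → Bits (Fin m) → W)
    (hψ : (ψ : Config (Qubit m 2) → W) = walkFamily nonzeroBit F)
    (hχ : (χ : Config (Qubit m 2) → W) = walkFamily nonzeroBit G)
    (hFG : ∀ b n a, n ≠ 0 → F b n a = G b n a) (hG : ∀ b a, G b 0 a = 0) :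
    queriedNormSq ψ = ‖χ‖ ^ 2 := by
  rw [norm_sq_eq_tsum, queriedNormSq, hψ, hχ]
  refine tsum_congr fun ⟨x, n⟩ => ?_
  by_cases hn : n = 0
  · subst hn
    by_cases hc : x Qubit.ctrl = 1 <;> simp [walkFamily, hc, hG, nonzeroBit]
  · by_cases hc : x Qubit.ctrl = 1 <;> simp [walkFamily, hc, hn, hFG, nonzeroBit]

end WalkFamily

/-! ### Reflecting oracles -/

section Reflection

variable {m : ℕ} {W : Type*} [NormedAddCommGroup W] [InnerProductSpace ℂ W]

/-- Multiplying the components of the state by a real function `χ` of mean zero under `p` gives a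
vector orthogonal to it, and still in the span of the `|a⟩|φ a⟩`. -/
lemma ReflectsAbout.apply_add {O : Oracle m W} {p : Bits (Fin m) → ℝ} {φ : Bits (Fin m) → W}
    (hO : ReflectsAbout O p φ) (hp : ∀ a, 0 ≤ p a) (hφ : ∀ a, ‖φ a‖ = 1)
    (χ : Bits (Fin m) → ℝ) (hχ : ∑ a, p a * χ a = 0) (α β : ℝ) :
    O (WithLp.toLp 2 fun a => ((α + β * χ a : ℝ) : ℂ) • answerState p φ a) =
      WithLp.toLp 2 fun a => ((α - β * χ a : ℝ) : ℂ) • answerState p φ a := by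
  set v : QubitsTensor m W := WithLp.toLp 2 fun a => ((χ a * Real.sqrt (p a) : ℝ) : ℂ) • φ a
    with hv
  have hneg : O v = -v := by
    refine hO.2 (fun a => ((χ a * Real.sqrt (p a) : ℝ) : ℂ)) ?_
    rw [PiLp.inner_apply]
    have : ∀ a, inner ℂ (answerState p φ a) (((χ a * Real.sqrt (p a) : ℝ) : ℂ) • φ a) =
        ((p a * χ a : ℝ) : ℂ) := by
      intro a
      rw [answerState, inner_smul_left, inner_smul_right, inner_self_eq_norm_sq_to_K, hφ]
      conv_rhs => rw [← Real.mul_self_sqrt (hp a)]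
      simp
      ring
    simp only [this]
    rw [← Complex.ofReal_sum, hχ, Complex.ofReal_zero]
  have hplus : (WithLp.toLp 2 fun a => ((α + β * χ a : ℝ) : ℂ) • answerState p φ a :
      QubitsTensor m W) = (α : ℂ) • answerState p φ + (β : ℂ) • v := by
    ext a
    simp only [PiLp.add_apply, PiLp.smul_apply, answerState, hv, smul_smul, ← add_smul]
    congr 1
    push_cast
    ring
  have hminus : (WithLp.toLp 2 fun a => ((α - β * χ a : ℝ) : ℂ) • answerState p φ a :
      QubitsTensor m W) = (α : ℂ) • answerState p φ + (β : ℂ) • -v := by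
    ext a
    simp only [PiLp.add_apply, PiLp.smul_apply, answerState, hv, smul_smul,
      smul_neg, ← neg_smul, ← add_smul]
    congr 1
    push_cast
    ring
  rw [hplus, hminus, map_add, map_smul, map_smul, hO.1, hneg]

/-- The probability of the answers whose inner product with `b` is `s`. -/
noncomputable def productProb (p : Bits (Fin m) → ℝ) (b : Bits (Fin m)) (s : ZMod 2) : ℝ :=
  ∑ a, if b ⬝ᵥ a = s then p a else 0

lemma le_productProb (p : Bits (Fin m) → ℝ) (hp : ∀ a, 0 ≤ p a) (b r : Bits (Fin m)) :
    p r ≤ productProb p b (b ⬝ᵥ r) := by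
  have h := Finset.single_le_sum (f := fun a => if b ⬝ᵥ a = b ⬝ᵥ r then p a else 0)
    (fun a _ => by split_ifs <;> simp [hp]) (Finset.mem_univ r)
  simpa [productProb] using h

lemma productProb_le_one (p : Bits (Fin m) → ℝ) (hp : ∀ a, 0 ≤ p a) (hp1 : ∑ a, p a = 1)
    (b : Bits (Fin m)) (s : ZMod 2) : productProb p b s ≤ 1 := by
  rw [← hp1]
  exact Finset.sum_le_sum fun a _ => by split_ifs <;> simp [hp]

lemma sum_mul_ite_product (p : Bits (Fin m) → ℝ) (hp1 : ∑ a, p a = 1) (b : Bits (Fin m))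
    (s : ZMod 2) (g : ZMod 2 → ℝ) :
    ∑ a, p a * g (b ⬝ᵥ a) =
      productProb p b s * g s + (1 - productProb p b s) * g (s + 1) := by
  rw [← hp1, productProb, ← Finset.sum_sub_distrib, Finset.sum_mul, Finset.sum_mul,
    ← Finset.sum_add_distrib]
  refine Finset.sum_congr rfl fun a _ => ?_
  have h : ∀ f s : ZMod 2, f ≠ s → s + 1 = f := by decide
  by_cases hs : b ⬝ᵥ a = s
  · simp [hs]
  · simp [hs, h _ _ hs]

variable {p : Bits (Fin m) → ℝ} {b : Bits (Fin m)} {s : ZMod 2} {w : ℝ}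

lemma sum_mul_negatedVector (hp1 : ∑ a, p a = 1)
    (hw : w * productProb p b s = 1 - productProb p b s) :
    ∑ a, p a * negatedVector s w (b ⬝ᵥ a) = 0 := by
  rw [sum_mul_ite_product p hp1 b s]
  rcases zmod_two_cases s with rfl | rfl <;>
    simp [negatedVector, CharTwo.add_self_eq_zero, ← hw] <;> ring

/-- The cross term is the mean of `negatedVector`, which is 0. Its second moment is `P * w ^ 2 + (1
- P) = w`, because `1 - P = w * P` and `P * (1 + w) = 1`. -/
lemma sum_mul_amplitude_sq (hp1 : ∑ a, p a = 1)
    (hw : w * productProb p b s = 1 - productProb p b s) (α β : ℝ) :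
    ∑ a, p a * (α + β * negatedVector s w (b ⬝ᵥ a)) ^ 2 = α ^ 2 + w * β ^ 2 := by
  rw [sum_mul_ite_product p hp1 b s fun f => (α + β * negatedVector s w f) ^ 2]
  rcases zmod_two_cases s with rfl | rfl <;>
    simp only [negatedVector, if_true, one_ne_zero, if_false, zero_add, CharTwo.add_self_eq_zero]
  · linear_combination (2 * α * β + w * β ^ 2 - β ^ 2) * hw
  · linear_combination (-2 * α * β + w * β ^ 2 - β ^ 2) * hw

end Reflection

/-! ### The transducer -/

section Purifier

variable {m : ℕ} {W : Type*} [NormedAddCommGroup W] [InnerProductSpace ℂ W]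

/-- The transducer that finds the majority answer with one query: the Bernstein-Vazirani algorithm
with a walk on the counter. -/
noncomputable def majorityTransducer (m : ℕ) : QueryAlgorithm m 2 where
  Q := 1
  U t := if t = 0 then hadamardLayer (List.finRange m) ++ [.nonzeroTest Qubit.ctrl]
    else walkStep m ++ hadamardLayer (List.finRange m).reverse

lemma majorityTransducer_time (m : ℕ) : (majorityTransducer m).time = 12 * m + 15 := by
  simp [QueryAlgorithm.time, majorityTransducer, Finset.sum_range_succ, walkStep, computeProduct,
    addInnerProduct_length, moveCounter, hadamardLayer]
  ring

/-- The content of the catalyst when the state of `B` is transformed by Hadamard operations. The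
ratio of the probabilities of the minority and the majority value of `b ⬝ᵥ a` is `w b`. -/
noncomputable def catalystContent (r : Bits (Fin m)) (w : Bits (Fin m) → ℝ)
    (Φ : QubitsTensor m W) (b : Bits (Fin m)) (n : ℤ) (a : Bits (Fin m)) : W :=
  (((Real.sqrt 2)⁻¹ ^ m * fixedAmplitude (b ⬝ᵥ r) (w b) n + (Real.sqrt 2)⁻¹ ^ m *
    negatedAmplitude (b ⬝ᵥ r) (w b) n * negatedVector (b ⬝ᵥ r) (w b) (b ⬝ᵥ a) : ℝ) : ℂ) • Φ a

/-- The content of the state `|r⟩|Φ⟩` when the state of `B` is transformed by Hadamard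
operations. -/
noncomputable def publicContent (r : Bits (Fin m)) (Φ : QubitsTensor m W) (b : Bits (Fin m))
    (n : ℤ) (a : Bits (Fin m)) : W :=
  if n = 0 then ((((Real.sqrt 2)⁻¹ ^ m : ℝ) : ℂ) * bitSign (b ⬝ᵥ r)) • Φ a else 0

lemma catalystContent_zero (r : Bits (Fin m)) (w : Bits (Fin m) → ℝ) (Φ : QubitsTensor m W)
    (b a : Bits (Fin m)) : catalystContent r w Φ b 0 a = 0 := by
  simp [catalystContent, fixedAmplitude_zero, negatedAmplitude_zero]

omit [InnerProductSpace ℂ W] in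
lemma walkFamily_add (c : ℤ → ZMod 2) (F G : Bits (Fin m) → ℤ → Bits (Fin m) → W) :
    walkFamily c F + walkFamily c G = walkFamily c fun b n a => F b n a + G b n a := by
  funext s
  simp only [walkFamily, Pi.add_apply]
  split_ifs <;> simp

/-- The query followed by the step of the walk turns the initial state with the catalyst into the
final state with the catalyst. -/
lemma walk_catalystContent {O : Oracle m W} {p : Bits (Fin m) → ℝ} {φ : Bits (Fin m) → W}
    (hO : ReflectsAbout O p φ) (hp : ∀ a, 0 ≤ p a) (hp1 : ∑ a, p a = 1) (hφ : ∀ a, ‖φ a‖ = 1)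
    (r : Bits (Fin m)) (w : Bits (Fin m) → ℝ)
    (hw : ∀ b, w b * productProb p b (b ⬝ᵥ r) = 1 - productProb p b (b ⬝ᵥ r))
    (ψ : StateSpace (Qubit m 2) W)
    (hψ : (ψ : Config (Qubit m 2) → W) = walkFamily nonzeroBit fun b n a =>
      publicContent 0 (answerState p φ) b n a + catalystContent r w (answerState p φ) b n a) :
    (circuitUnitary W (walkStep m) (queryOp 2 O ψ) : Config (Qubit m 2) → W) =
      walkFamily 0 fun b n a =>
        publicContent r (answerState p φ) b n a + catalystContent r w (answerState p φ) b n a := by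
  rw [walkStep_apply _ _ (queryOp_walkFamily O ψ _ hψ)]
  congr 1
  funext b n a
  -- For fixed `b` the query only changes the sign of the negated part. At the origin both parts of
  -- the catalyst are 0 and the public amplitude 1 remains; the sign of `publicContent 0` is
  -- trivial.
  have hquery : ∀ k : ℤ, (if k = 0 then
      publicContent 0 (answerState p φ) b k a + catalystContent r w (answerState p φ) b k a
      else O (WithLp.toLp 2 fun a => publicContent 0 (answerState p φ) b k a +
        catalystContent r w (answerState p φ) b k a) a) =
      ((((Real.sqrt 2)⁻¹ ^ m : ℝ) : ℂ) * ((fixedAmplitude (b ⬝ᵥ r) (w b) k -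
        negatedAmplitude (b ⬝ᵥ r) (w b) k * negatedVector (b ⬝ᵥ r) (w b) (b ⬝ᵥ a) +
          if k = 0 then 1 else 0 : ℝ) : ℂ)) • answerState p φ a := by
    intro k
    by_cases hk : k = 0
    · subst hk
      simp [publicContent, catalystContent_zero, fixedAmplitude_zero, negatedAmplitude_zero]
    · simp only [if_neg hk, publicContent, zero_add, catalystContent]
      rw [hO.apply_add hp hφ (fun a => negatedVector (b ⬝ᵥ r) (w b) (b ⬝ᵥ a))
        (sum_mul_negatedVector hp1 (hw b)), ← Complex.ofReal_mul, add_zero, mul_sub, ← mul_assoc]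
  have key := walkPhase_mul_amplitude (b ⬝ᵥ r) (w b) (b ⬝ᵥ a) n
  refine (congrArg (walkPhase (b ⬝ᵥ a) (walkSource (b ⬝ᵥ a) n) • ·) (hquery _)).trans ?_
  rw [smul_smul, mul_left_comm, key]
  simp only [publicContent, catalystContent]
  by_cases hn : n = 0
  · rw [if_pos hn, if_pos hn, ← add_smul]
    congr 1
    push_cast
    ring
  · rw [if_neg hn, if_neg hn, zero_add, add_zero]
    congr 1
    push_cast
    ring

lemma hasSum_catalystContent {p : Bits (Fin m) → ℝ} {φ : Bits (Fin m) → W}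
    (hp : ∀ a, 0 ≤ p a) (hp1 : ∑ a, p a = 1) (hφ : ∀ a, ‖φ a‖ = 1) (r : Bits (Fin m))
    (w : Bits (Fin m) → ℝ) (b : Bits (Fin m)) (hw0 : 0 ≤ w b) (hw1 : w b < 1)
    (hw : w b * productProb p b (b ⬝ᵥ r) = 1 - productProb p b (b ⬝ᵥ r)) :
    HasSum (fun n => ∑ a, ‖catalystContent r w (answerState p φ) b n a‖ ^ 2)
      (1 / 2 ^ m * ((1 + w b) / (1 - w b))) := by
  have hN : ((Real.sqrt 2)⁻¹ ^ m) ^ 2 = 1 / 2 ^ m := by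
    rw [← pow_mul, mul_comm, pow_mul, inv_pow, Real.sq_sqrt (by norm_num)]
    simp
  refine ((hasSum_amplitude_sq (b ⬝ᵥ r) hw0 hw1).mul_left (1 / 2 ^ m)).congr_fun fun n => ?_
  rw [← sum_mul_amplitude_sq hp1 hw, Finset.mul_sum]
  refine Finset.sum_congr rfl fun a _ => ?_
  rw [catalystContent, answerState, norm_smul, norm_smul, hφ, Complex.norm_real, Complex.norm_real,
    mul_one, mul_pow, Real.norm_eq_abs, Real.norm_eq_abs, sq_abs, sq_abs, Real.sq_sqrt (hp a), ← hN]
  ring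

/-- The catalyst of the transducer. -/
lemma exists_catalyst {O : Oracle m W} {p : Bits (Fin m) → ℝ} {φ : Bits (Fin m) → W}
    (hO : ReflectsAbout O p φ) (hp : ∀ a, 0 ≤ p a) (hp1 : ∑ a, p a = 1) (hφ : ∀ a, ‖φ a‖ = 1)
    (r : Bits (Fin m)) (hr : 1 / 2 < p r) :
    ∃ v : StateSpace (Qubit m 2) W,
      Transduces ((majorityTransducer m).action O) (publicSpace m 2 W)
        (publicState 2 0 (answerState p φ)) (publicState 2 r (answerState p φ)) v ∧
      (majorityTransducer m).lasVegas O (publicState 2 0 (answerState p φ) + v) = ‖v‖ ^ 2 ∧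
      ‖v‖ ^ 2 ≤ 1 / (2 * (p r - 1 / 2)) := by
  set Φ := answerState p φ
  set P : Bits (Fin m) → ℝ := fun b => productProb p b (b ⬝ᵥ r)
  -- The decay ratio is tuned to each `b` separately. It occurs only in the catalyst, so the
  -- algorithm need not know it.
  set w : Bits (Fin m) → ℝ := fun b => (1 - P b) / P b
  have hPr : ∀ b, p r ≤ P b := fun b => le_productProb p hp b r
  have hP1 : ∀ b, P b ≤ 1 := fun b => productProb_le_one p hp hp1 b _
  have hP0 : ∀ b, 0 < P b := fun b => by linarith [hPr b]
  have hw : ∀ b, w b * P b = 1 - P b := fun b => div_mul_cancel₀ _ (hP0 b).ne'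
  have hw0 : ∀ b, 0 ≤ w b := fun b => div_nonneg (by linarith [hP1 b]) (hP0 b).le
  have hw1 : ∀ b, w b < 1 := fun b => (div_lt_one (hP0 b)).2 (by linarith [hPr b])
  have hE : ∀ b, HasSum (fun n => ∑ a, ‖catalystContent r w Φ b n a‖ ^ 2)
      (1 / 2 ^ m * ((1 + w b) / (1 - w b))) := fun b =>
    hasSum_catalystContent hp hp1 hφ r w b (hw0 b) (hw1 b) (hw b)
  have henergy := energy_walkFamily 0 _ _ hE
  have hmem : Memℓp (walkFamily 0 (catalystContent r w Φ)) 2 := by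
    rw [← energy_ne_top_iff, henergy]
    exact ENNReal.ofReal_ne_top
  -- This is the catalyst seen between the two layers of Hadamard operations; the catalyst itself is
  -- `H' core`.
  set core : StateSpace (Qubit m 2) W := ⟨_, hmem⟩ with hcore
  have hcoe : (core : Config (Qubit m 2) → W) = walkFamily 0 (catalystContent r w Φ) := rfl
  set H := circuitUnitary W (hadamardLayer (List.finRange m)) with hH
  set H' := circuitUnitary W (hadamardLayer (List.finRange m).reverse) with hH'
  have hH'H : ∀ ψ, H' (H ψ) = ψ := hadamardLayer_reverse_apply _
  have hHH' : ∀ ψ, H (H' ψ) = ψ := fun ψ => by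
    have h := hadamardLayer_reverse_apply (List.finRange m).reverse ψ
    rwa [List.reverse_reverse] at h
  have hpub : ∀ s : Bits (Fin m), (H (publicState 2 s Φ) : Config (Qubit m 2) → W) =
      walkFamily 0 (publicContent s Φ) := fun s => hadamardLayer_publicState s Φ
  set ψ := (Gate.nonzeroTest Qubit.ctrl).unitary W (H (publicState 2 0 Φ) + core) with hψ
  have hψF : (ψ : Config (Qubit m 2) → W) = walkFamily nonzeroBit fun b n a =>
      publicContent 0 Φ b n a + catalystContent r w Φ b n a := by
    refine nonzeroTest_walkFamily _ _ ?_
    rw [lp.coeFn_add, hpub, hcoe, walkFamily_add]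
  have hfinal : circuitUnitary W (walkStep m) (queryOp 2 O ψ) = H (publicState 2 r Φ) + core := by
    apply lp.ext
    rw [walk_catalystContent hO hp hp1 hφ r w hw ψ hψF, lp.coeFn_add, hpub, hcoe, walkFamily_add]
  have hinit : (majorityTransducer m).partialAction O 0 (publicState 2 0 Φ + H' core) = ψ := by
    change circuitUnitary W (hadamardLayer (List.finRange m) ++ [.nonzeroTest Qubit.ctrl]) _ = _
    rw [circuitUnitary_append, ← hH, map_add, hHH']
    rfl
  have hcore_norm : ‖core‖ ^ 2 = ∑ b, 1 / 2 ^ m * ((1 + w b) / (1 - w b)) := by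
    have h := energy_coe core
    rw [hcoe, henergy, ENNReal.ofReal_eq_ofReal_iff
      (Finset.sum_nonneg fun b _ => (hE b).nonneg fun n => by positivity) (by positivity)] at h
    exact h.symm
  refine ⟨H' core, ⟨publicState_mem _ _, publicState_mem _ _, ?_, ?_⟩, ?_, ?_⟩
  · refine (VanishesOnPublic.hadamardLayer ?_ _).mem_orthogonal
    rintro ⟨x, n⟩ ⟨hn, -⟩
    rw [hcoe, walkFamily]
    simp only at hn
    subst hn
    simp [catalystContent_zero]
  · change circuitUnitary W (walkStep m ++ hadamardLayer (List.finRange m).reverse)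
      (queryOp 2 O ((majorityTransducer m).partialAction O 0 (publicState 2 0 Φ + H' core))) = _
    rw [hinit, circuitUnitary_append, hfinal, ← hH', map_add, hH'H]
  · rw [LinearIsometryEquiv.norm_map]
    change ∑ t ∈ Finset.range 1, queriedNormSq _ = _
    rw [Finset.sum_range_one, hinit, queriedNormSq_walkFamily ψ
      ((Gate.nonzeroTest Qubit.ctrl).unitary W core) _ (catalystContent r w Φ) hψF
      (nonzeroTest_walkFamily _ _ hcoe), LinearIsometryEquiv.norm_map]
    · intro b n a hn
      rw [publicContent, if_neg hn, zero_add]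
    · exact catalystContent_zero r w Φ
  · rw [LinearIsometryEquiv.norm_map, hcore_norm]
    have hb : ∀ b, (1 + w b) / (1 - w b) ≤ 1 / (2 * (p r - 1 / 2)) := by
      intro b
      have h0 := hP0 b
      have h1 : 0 < 2 * P b - 1 := by linarith [hPr b]
      -- Substitute `w = (1 - P) / P`; the bound then follows from `P b ≥ p r`.
      have h : (1 + w b) / (1 - w b) = 1 / (2 * P b - 1) := by
        rw [div_eq_div_iff (by linarith [hw1 b]) h1.ne']
        linear_combination 2 * hw b
      rw [h]
      exact one_div_le_one_div_of_le (by linarith) (by linarith [hPr b])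
    calc ∑ b, 1 / 2 ^ m * ((1 + w b) / (1 - w b))
        ≤ ∑ _b : Bits (Fin m), 1 / 2 ^ m * (1 / (2 * (p r - 1 / 2))) :=
          Finset.sum_le_sum fun b _ => mul_le_mul_of_nonneg_left (hb b) (by positivity)
      _ = 1 / (2 * (p r - 1 / 2)) := by
          rw [Finset.sum_const, Finset.card_univ, Fintype.card_fun, ZMod.card, Fintype.card_fin,
            nsmul_eq_mul, ← mul_assoc]
          push_cast
          rw [mul_one_div_cancel (by positivity), one_mul]

end Purifier

theorem corollary7p3 :
    ∃ C : ℝ, ∀ (m : ℕ) (W : Type*) [NormedAddCommGroup W] [InnerProductSpace ℂ W]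
      [CompleteSpace W],
      ∃ (k : ℕ) (S : QueryAlgorithm m k),
        (S.time : ℝ) ≤ C * m ∧
        ∀ (p : Bits (Fin m) → ℝ) (φ : Bits (Fin m) → W) (r : Bits (Fin m)) (O : Oracle m W),
          (∀ a, 0 ≤ p a) → ∑ a, p a = 1 → (∀ a, ‖φ a‖ = 1) → 1 / 2 < p r →
          ReflectsAbout O p φ →
          ∃ v : StateSpace (Qubit m k) W,
            Transduces (S.action O) (publicSpace m k W)
              (publicState k 0 (answerState p φ)) (publicState k r (answerState p φ)) v ∧
            S.lasVegas O (publicState k 0 (answerState p φ) + v) ≤ 1 / (2 * (p r - 1 / 2)) ∧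
            ‖v‖ ^ 2 ≤ C / (p r - 1 / 2) := by
  -- For `m ≥ 1` the time `12 * m + 15` is at most `27 * m`. The catalyst bound alone would need
  -- only the constant `1 / 2`.
  refine ⟨27, fun m W _ _ _ => ?_⟩
  rcases Nat.eq_zero_or_pos m with rfl | hm
  -- For `m = 0` the time bound allows no gate at all. The empty algorithm with zero catalyst works,
  -- since the only bit-string `r` is 0.
  · refine ⟨2, ⟨0, fun _ => []⟩, by simp [QueryAlgorithm.time], fun p φ r O _ _ _ hr _ => ?_⟩
    have hδ : 0 < p r - 1 / 2 := by linarith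
    refine ⟨0, ⟨publicState_mem _ _, publicState_mem _ _, Submodule.zero_mem _, ?_⟩, ?_, ?_⟩
    · rw [Subsingleton.elim r 0]
      rfl
    · simp only [QueryAlgorithm.lasVegas, Finset.range_zero, Finset.sum_empty]
      positivity
    · rw [norm_zero, zero_pow two_ne_zero]
      positivity
  · refine ⟨2, majorityTransducer m, ?_, fun p φ r O hp hp1 hφ hr hO => ?_⟩
    · rw [majorityTransducer_time]
      have : (1 : ℝ) ≤ m := by exact_mod_cast hm
      push_cast
      linarith
    · have hδ : 0 < p r - 1 / 2 := by linarith
      obtain ⟨v, h1, h2, h3⟩ := exists_catalyst hO hp hp1 hφ r hr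
      refine ⟨v, h1, h2.trans_le h3, h3.trans ?_⟩
      rw [div_le_div_iff₀ (by positivity) hδ]
      linarith
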